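/- Consider a cellular network in the plane $\mathbb R^2$. **Model.** The base stations (BSs) form a homogeneous Poisson point process $\Psi$ of density $\lambda_{\rm BS}>0$. Let $\mathsf S$ be a finite set of link states. A link of length $r$ is in state $s\in\mathsf S$ with probability given by the multi-ball model with $\mathcal B$ balls, $$p_s(r)=\sum_{b=1}^{\mathcal B+1} q_s^{b}\,\mathbf 1\{D_{b-1}\le r<D_b\},\qquad 0=D_0\le D_1\le\dots\le D_{\mathcal B+1}=\infty,\quad q_s^b\ge 0,\quad \sum_{s\in\mathsf S} q_s^b=1 .$$ A link of length $r$ in state $s$ has path-loss $l_s(r)=\kappa_s r^{\alpha_s}$ with $\kappa_s,\alpha_s>0$, and log-normal shadowing $\mathcal X_s$ with mean $\mu_s$ and standard deviation $\sigma_s>0$ in dB, i.e. with density $\frac{10}{\ln 10}\frac{1}{\sqrt{2\pi}\,\sigma_s x}\exp\!\big(-\frac{(10\log_{10}x-\mu_s)^2}{2\sigma_s^2}\big)$ on $x>0$. For each location $z$, given the BSs, the pairs (state, shadowing) of the links between $z$ and the different BSs are independent; more precisely, every BS $x\in\Psi$ carries an independent, identically distributed mark that determines, jointly measurably in the displacement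 $z-x$ and the mark, the state and the shadowing of its link to each location $z$. A location $z$ is served by a BS that minimizes $L=l_s(r)/\mathcal X$ over all BSs, where $r$, $s$ and $\mathcal X$ are the length, state and shadowing of the link to $z$. The cell of a BS is the (not necessarily connected) set of all locations that it serves. Let $\Pr^0,\mathbb E^0$ denote probability and expectation under the Palm distribution of the marked point process, under which a typical BS, ${\rm BS}^{(0)}$, is located at the origin. It is given, for any Borel set $W$ with $0<|W|<\infty$, by $\mathbb E^0\{f\}=\frac1{\lambda_{\rm BS}|W|}\,\mathbb E\sum_{x\in\Psi\cap W} f(\text{configuration seen from }x)$. Let $\mathrm{area}$ be the Lebesgue measure of the cell of ${\rm BS}^{(0)}$. For the typical mobile terminal at the origin, under the stationary distribution, let $L_s^{(0)}$ be the minimum of $L$ over the BSs whose link to it is in state $s$ ($+\infty$ if there are none), and let $\mathcal A_s$ be the probability that it is served by a BS whose link to it is in state $s$. Let $$\Lambda_s([0,\xi))=2\pi\lambda_{\rm BS}\,\mathbb E_{\mathcal X_s}\Big\{\int_0^{(\mathcal X_s\xi/\kappa_s)^{1/\alpha_s}}p_s(r)\,r\,dr\Big\}.$$ **Lemma.** $\Pr^0$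 is a probability measure and the area of the cell of ${\rm BS}^{(0)}$ is a random variable. With $\Pr^0\{r\in\mathsf C_s\}$ the conditional probability that a fixed location at distance $r$ from ${\rm BS}^{(0)}$ (in any fixed direction) is served by ${\rm BS}^{(0)}$, given that its link to ${\rm BS}^{(0)}$ is in state $s$ (a term with $p_s(r)=0$ is read as $0$), and with $L_{\tilde s}$ the minimum of $L$ at this location over the BSs other than ${\rm BS}^{(0)}$ whose link to it is in state $\tilde s$, $$\begin{aligned}\mathbb E^0\{\mathrm{area}\}&=2\pi\sum_{s\in\mathsf S}\int_0^\infty \Pr{}^0\{r\in\mathsf C_s\}\,p_s(r)\,r\,dr\\ &=2\pi\sum_{s\in\mathsf S}\int_0^\infty\mathbb E_{\mathcal X_s}\Big\{\prod_{\tilde s\in\mathsf S}\Pr{}^0\Big\{L_{\tilde s}>\frac{\kappa_s r^{\alpha_s}}{\mathcal X_s}\,\Big|\,\mathcal X_s\Big\}\Big\}\,p_s(r)\,r\,dr\\ &=2\pi\sum_{s\in\mathsf S}\int_0^\infty\mathbb E_{\mathcal X_s}\Big\{\exp\Big(-\sum_{\tilde s\in\mathsf S}2\pi\lambda_{\rm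 BS}\,\mathbb E_{\mathcal X_{\tilde s}}\Big\{\int_0^{c_{s,\tilde s}(r,\mathcal X_{\tilde s},\mathcal X_s)}p_{\tilde s}(\tilde r)\,\tilde r\,d\tilde r\Big\}\Big)\Big\}\,p_s(r)\,r\,dr\\ &=\sum_{s\in\mathsf S}\frac{\mathcal A_s}{\lambda_{\rm BS}}=\frac1{\lambda_{\rm BS}},\end{aligned}$$ where $c_{s,\tilde s}(r,x',x)=\big(\frac{x'}{x}\,\frac{\kappa_s}{\kappa_{\tilde s}}\,r^{\alpha_s}\big)^{1/\alpha_{\tilde s}}$, and $\mathcal X_s$, $\mathcal X_{\tilde s}$ are independent shadowing variables. In the second line the event $L_{\tilde s}>\cdot$ means that every BS other than ${\rm BS}^{(0)}$ whose link to the location is in state $\tilde s$ has $L>\cdot$. Moreover, for every $s\in\mathsf S$, $$\mathcal A_s=\mathbb E\Big\{\prod_{\tilde s\ne s}\Pr\{L^{(0)}_{\tilde s}>L^{(0)}_s\mid L^{(0)}_s\}\Big\}=\int_0^\infty\prod_{\tilde s\neq s}\Pr\{L_{\tilde s}^{(0)}>x\}\,f_{L_s^{(0)}}(x)\,dx,$$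 where $f_{L_s^{(0)}}$ is the density of $L_s^{(0)}$ on $(0,\infty)$ (the law of $L_s^{(0)}$ restricted to finite values is absolutely continuous), and the void probabilities are $\Pr\{L_s^{(0)}>x\}=\exp(-\Lambda_s([0,x)))$ for all $x\ge0$. -/

import Mathlib

open MeasureTheory ProbabilityTheory Set
open scoped ENNReal

noncomputable section

/-- The Euclidean plane. -/
abbrev Plane : Type := EuclideanSpace ℝ (Fin 2)

/-- Deterministic parameters of the network with finite set `S` of link states:
density of base stations, path-loss constants and slopes, shadowing mean and standard deviation
(in dB), and the multi-ball link state model with `numBalls` balls.  The radii are indexed so that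
`D 0 = 0` and `D (numBalls + 1) = ∞`; `q b s` is the probability of state `s` for link lengths in
`[D b, D (b + 1))`. -/
structure NetworkParams (S : Type*) [Fintype S] where
  lam : ℝ
  lam_pos : 0 < lam
  kappa : S → ℝ
  kappa_pos : ∀ s, 0 < kappa s
  alpha : S → ℝ
  alpha_pos : ∀ s, 0 < alpha s
  mu : S → ℝ
  sigma : S → ℝ
  sigma_pos : ∀ s, 0 < sigma s
  numBalls : ℕ
  D : Fin (numBalls + 2) → ℝ≥0∞
  D_zero : D 0 = 0
  D_last : D (Fin.last (numBalls + 1)) = ⊤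
  D_mono : Monotone D
  q : Fin (numBalls + 1) → S → ℝ
  q_nonneg : ∀ b s, 0 ≤ q b s
  q_sum : ∀ b, ∑ s, q b s = 1

namespace NetworkParams

variable {S : Type*} [Fintype S] (N : NetworkParams S)

/-- Multi-ball link state model: probability that a link of length `r` is in state `s`. -/
def p (s : S) (r : ℝ) : ℝ :=
  ∑ b : Fin (N.numBalls + 1),
    N.q b s * indicator {ρ : ℝ | N.D b.castSucc ≤ ENNReal.ofReal ρ ∧
      ENNReal.ofReal ρ < N.D b.succ} (fun _ => (1 : ℝ)) r

/-- Distance-dependent path-loss in state `s`. -/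
def pathLoss (s : S) (r : ℝ) : ℝ := N.kappa s * r ^ N.alpha s

/-- Log-normal density of the shadowing in state `s`, parameters in dB. -/
def shadowPDF (s : S) (x : ℝ) : ℝ :=
  if 0 < x then
    10 / Real.log 10 * (1 / (Real.sqrt (2 * Real.pi) * N.sigma s * x)) *
      Real.exp (-(10 * Real.logb 10 x - N.mu s) ^ 2 / (2 * N.sigma s ^ 2))
  else 0

/-- Law of the shadowing in state `s`. -/
def shadowLaw (s : S) : Measure ℝ :=
  volume.withDensity (fun x => ENNReal.ofReal (N.shadowPDF s x))

/-- Intensity of `[0, ξ)` for the point process of the inverse average received powers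
of the links in state `s`. -/
def Lambda (s : S) (ξ : ℝ) : ℝ :=
  2 * Real.pi * N.lam * ∫ x, (∫ r in (0 : ℝ)..(x * ξ / N.kappa s) ^ (1 / N.alpha s),
    N.p s r * r) ∂(N.shadowLaw s)

/-- The radius within which a base station in state `t` with shadowing `x'` beats a link of length
`r` in state `s` with shadowing `x`. -/
def cRadius (s t : S) (r x' x : ℝ) : ℝ :=
  ((x' / x) * (N.kappa s / N.kappa t) * r ^ N.alpha s) ^ (1 / N.alpha t)

end NetworkParams

/-- Random link states and shadowings.  A base station carries a mark `m`, drawn from `ν`; the link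
between it and the location at displacement `y` from it is in state `state y m` and has shadowing
`shadow y m`.  Only the law at each displacement is prescribed; the joint law of the links of one
base station to several locations is arbitrary. -/
structure LinkField {S : Type*} [Fintype S] [MeasurableSpace S] (N : NetworkParams S)
    {M : Type*} [MeasurableSpace M] (ν : Measure M) where
  state : Plane → M → S
  shadow : Plane → M → ℝ
  measurable_state : Measurable (Function.uncurry state)
  measurable_shadow : Measurable (Function.uncurry shadow)
  law : ∀ (y : Plane) (s : S) (A : Set ℝ), MeasurableSet A →
    ν {m | state y m = s ∧ shadow y m ∈ A} = ENNReal.ofReal (N.p s ‖y‖) * N.shadowLaw s A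

/-- Positions and marks of the (enumerated) base stations. -/
abbrev Config (M : Type*) : Type _ := ℕ → Plane × M

namespace LinkField

variable {S : Type*} [Fintype S] [MeasurableSpace S] {N : NetworkParams S}
  {M : Type*} [MeasurableSpace M] {ν : Measure M} (F : LinkField N ν)

/-- State of the link between the location `z` and the base station `b`. -/
def linkState (z : Plane) (b : Plane × M) : S := F.state (z - b.1) b.2

/-- Inverse average received power at `z` from the base station `b`. -/
def invPower (z : Plane) (b : Plane × M) : ℝ :=
  N.pathLoss (F.linkState z b) ‖z - b.1‖ / F.shadow (z - b.1) b.2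

/-- The `n`-th base station of `c` serves `z`: it minimizes the inverse average received power. -/
def Serves (c : Config M) (n : ℕ) (z : Plane) : Prop :=
  ∀ k, F.invPower z (c n) ≤ F.invPower z (c k)

/-- Cell of the `n`-th base station. -/
def cell (c : Config M) (n : ℕ) : Set Plane := {z | F.Serves c n z}

/-- Smallest inverse average received power at the origin among links in state `s`
(`∞` if there is none). -/
def minInvPower (s : S) (c : Config M) : ℝ≥0∞ :=
  open Classical in
  ⨅ n, if F.linkState 0 (c n) = s then ENNReal.ofReal (F.invPower 0 (c n)) else ⊤

end LinkField

/-- Number of points of the enumerated point process `X` in `A`. -/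
def pointCount {Ω : Type*} (X : ℕ → Ω → Plane) (A : Set Plane) (ω : Ω) : ℕ∞ :=
  {n | X n ω ∈ A}.encard

/-- The points `X 0, X 1, …` form a homogeneous Poisson point process of density `lam` in the
plane. -/
structure IsHomogeneousPPP {Ω : Type*} [MeasurableSpace Ω] (P : Measure Ω) (lam : ℝ)
    (X : ℕ → Ω → Plane) : Prop where
  measurable : ∀ n, Measurable (X n)
  count_law : ∀ A : Set Plane, MeasurableSet A → volume A < ⊤ → ∀ k : ℕ,
    P {ω | pointCount X A ω = k} = poissonMeasure (lam * (volume A).toReal).toNNReal {k}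
  count_indep : ∀ (j : ℕ) (A : Fin j → Set Plane), (∀ i, MeasurableSet (A i)) →
    (∀ i, volume (A i) < ⊤) → Pairwise (fun i i' => Disjoint (A i) (A i')) →
    iIndepFun (fun i => pointCount X (A i)) P

/-- The marks `K n` are i.i.d. with law `ν` and independent of the points `X n`. -/
structure IsIndependentMarking {Ω : Type*} [MeasurableSpace Ω] (P : Measure Ω)
    (X : ℕ → Ω → Plane) {M : Type*} [MeasurableSpace M] (ν : Measure M) (K : ℕ → Ω → M) :
    Prop where
  measurable : ∀ n, Measurable (K n)
  law : ∀ n, P.map (K n) = ν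
  iid : iIndepFun K P
  indep : IndepFun (fun ω n => X n ω) (fun ω n => K n ω) P

section Palm

variable {Ω : Type*} [MeasurableSpace Ω] {M : Type*} [MeasurableSpace M]

/-- The random configuration of base stations. -/
def config (X : ℕ → Ω → Plane) (K : ℕ → Ω → M) (ω : Ω) : Config M := fun k => (X k ω, K k ω)

/-- Palm distribution of a stationary marked point process of density `lam`, computed with the
window `W`: the measure
`A ↦ (lam * |W|)⁻¹ * E[∑ n, 1{X n ∈ W} 1{configuration seen from X n belongs to A}]`.
A point `(n, c)` consists of the configuration `c`, translated so that the typical base station is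
at the origin, and of the index `n` of the typical base station. -/
def palm (P : Measure Ω) (lam : ℝ) (X : ℕ → Ω → Plane) (K : ℕ → Ω → M) (W : Set Plane) :
    Measure (ℕ × Config M) :=
  (ENNReal.ofReal lam * volume W)⁻¹ •
    Measure.sum (fun n => (P.restrict {ω | X n ω ∈ W}).map
      (fun ω => (n, fun k => (X k ω - X n ω, K k ω))))

end Palm

section Association

variable {S : Type*} [Fintype S] [MeasurableSpace S] {N : NetworkParams S}
  {M : Type*} [MeasurableSpace M] {ν : Measure M}
  {Ω : Type*} [MeasurableSpace Ω]

/-- Mean area (Lebesgue measure) of the cell of the typical base station under `Q`. -/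
def meanCellArea (F : LinkField N ν) (Q : Measure (ℕ × Config M)) : ℝ≥0∞ :=
  ∫⁻ a, volume (F.cell a.2 a.1) ∂Q

/-- Probability that the typical mobile terminal, at the origin, is served by a base station whose
link with it is in state `s`. -/
def assocProb (P : Measure Ω) (F : LinkField N ν) (X : ℕ → Ω → Plane) (K : ℕ → Ω → M)
    (s : S) : ℝ≥0∞ :=
  P {ω | ∃ n, F.Serves (config X K ω) n 0 ∧ F.linkState 0 (config X K ω n) = s}

/-- Smallest inverse average received power at the typical mobile terminal in state `s`. -/
def minLink (F : LinkField N ν) (X : ℕ → Ω → Plane) (K : ℕ → Ω → M) (s : S) (ω : Ω) : ℝ≥0∞ :=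
  F.minInvPower s (config X K ω)

/-- The law of `minLink` on the event that it is finite (a sub-probability measure on `ℝ`). -/
def minLinkLaw (P : Measure Ω) (F : LinkField N ν) (X : ℕ → Ω → Plane) (K : ℕ → Ω → M)
    (s : S) : Measure ℝ :=
  (P.restrict {ω | minLink F X K s ω ≠ ⊤}).map (fun ω => (minLink F X K s ω).toReal)

/-- Probability density function of `minLink`. -/
def minLinkPDF (P : Measure Ω) (F : LinkField N ν) (X : ℕ → Ω → Plane) (K : ℕ → Ω → M)
    (s : S) : ℝ → ℝ≥0∞ :=
  (minLinkLaw P F X K s).rnDeriv volume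

end Association

end

/-!
A Poisson process is determined by its Laplace functional `h ↦ exp (-∫ (1 - exp (-h)) dμ)`, and
attaching independent marks multiplies its intensity by the mark distribution. Tilting the
Laplace functional gives the Slivnyak-Mecke formula, so that the base stations other than the
typical one form, under the Palm distribution, again a Poisson process. In polar coordinates the
inverse powers received at a fixed location through links in state `s` have the intensity
`linkIntensity s`, whose distribution function is `Λ s`. A location at distance `r` is thus served
by the typical base station through a link in state `s` with probability
`p s r * E exp (-∑ t, Λ t (κ s * r ^ α s / 𝒳 s))`, and integrating over the plane gives the mean
cell area. The same formula with the terminal at the origin gives the association probabilities,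
which add up to one because almost surely exactly one base station serves the origin. The void
probabilities factorize over the link states, so the minima of the inverse power over the links in
each state are independent, and the association probabilities are those of a race between them.
-/

noncomputable section

section ExpNeg

/-- The function `x ↦ exp (-x)` on `[0, ∞]`. -/
def expNeg (x : ℝ≥0∞) : ℝ≥0∞ := EReal.exp (-(x : EReal))

/-- The inverse `x ↦ -log x` of `expNeg`, extended by `0` beyond `1`. -/
def negLog (x : ℝ≥0∞) : ℝ≥0∞ := (-(ENNReal.log x)).toENNReal

@[simp] lemma expNeg_zero : expNeg 0 = 1 := by simp [expNeg]

@[simp] lemma expNeg_top : expNeg ⊤ = 0 := by simp [expNeg]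

lemma expNeg_antitone : Antitone expNeg := fun _ _ h =>
  EReal.exp_monotone (EReal.neg_le_neg_iff.2 (EReal.coe_ennreal_le_coe_ennreal_iff.2 h))

lemma expNeg_le_one (x : ℝ≥0∞) : expNeg x ≤ 1 := by
  simpa only [expNeg_zero] using expNeg_antitone (zero_le (a := x))

lemma expNeg_ne_top (x : ℝ≥0∞) : expNeg x ≠ ⊤ :=
  ne_top_of_le_ne_top ENNReal.one_ne_top (expNeg_le_one x)

lemma continuous_expNeg : Continuous expNeg :=
  ENNReal.continuous_exp.comp (continuous_neg.comp continuous_coe_ennreal_ereal)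

@[fun_prop]
lemma measurable_expNeg : Measurable expNeg := continuous_expNeg.measurable

lemma expNeg_eq_zero {x : ℝ≥0∞} : expNeg x = 0 ↔ x = ⊤ := by
  simp [expNeg]

lemma expNeg_ofReal {x : ℝ} (hx : 0 ≤ x) :
    expNeg (ENNReal.ofReal x) = ENNReal.ofReal (Real.exp (-x)) := by
  rw [expNeg, EReal.coe_ennreal_ofReal, max_eq_left hx, ← EReal.coe_neg, EReal.exp_coe]

lemma expNeg_add (x y : ℝ≥0∞) : expNeg (x + y) = expNeg x * expNeg y := by
  rw [expNeg, EReal.coe_ennreal_add, EReal.neg_add (by simp) (by simp), sub_eq_add_neg,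
    EReal.exp_add]
  rfl

lemma expNeg_sum {ι : Type*} (s : Finset ι) (f : ι → ℝ≥0∞) :
    expNeg (∑ i ∈ s, f i) = ∏ i ∈ s, expNeg (f i) := by
  classical
  induction s using Finset.induction_on with
  | empty => simp
  | insert a s ha ih => rw [Finset.sum_insert ha, Finset.prod_insert ha, expNeg_add, ih]

lemma expNeg_mul_natCast (a : ℝ≥0∞) (k : ℕ) : expNeg (a * k) = expNeg a ^ k := by
  simpa [mul_comm] using expNeg_sum (Finset.range k) (fun _ => a)

@[fun_prop]
lemma measurable_negLog : Measurable negLog := by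
  unfold negLog
  fun_prop

lemma expNeg_negLog {x : ℝ≥0∞} (hx : x ≤ 1) : expNeg (negLog x) = x := by
  have h : 0 ≤ -(ENNReal.log x) := by simpa using hx
  rw [expNeg, negLog, EReal.coe_toENNReal h, neg_neg, ENNReal.exp_log]

lemma negLog_expNeg (x : ℝ≥0∞) : negLog (expNeg x) = x := by
  rw [negLog, expNeg, EReal.log_exp, neg_neg, EReal.toENNReal_coe]

lemma monotone_one_sub_expNeg : Monotone fun x => 1 - expNeg x :=
  fun _ _ h => tsub_le_tsub_left (expNeg_antitone h) 1

lemma continuous_one_sub_expNeg : Continuous fun x => 1 - expNeg x :=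
  (ENNReal.continuous_sub_left ENNReal.one_ne_top).comp continuous_expNeg

lemma tendsto_lintegral_expNeg {α : Type*} [MeasurableSpace α] {Q : Measure α}
    [IsFiniteMeasure Q] {f : ℕ → α → ℝ≥0∞} {g : α → ℝ≥0∞} (hf : ∀ j, Measurable (f j))
    (h : ∀ a, Filter.Tendsto (fun j => f j a) Filter.atTop (nhds (g a))) :
    Filter.Tendsto (fun j => ∫⁻ a, expNeg (f j a) ∂Q) Filter.atTop
      (nhds (∫⁻ a, expNeg (g a) ∂Q)) :=
  tendsto_lintegral_of_dominated_convergence (fun _ => 1)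
    (fun j => measurable_expNeg.comp (hf j)) (fun _ => ae_of_all _ fun _ => expNeg_le_one _)
    (by simp) (ae_of_all _ fun a => (continuous_expNeg.tendsto _).comp (h a))

lemma lintegral_expNeg_ne_top {α : Type*} [MeasurableSpace α] (Q : Measure α)
    [IsFiniteMeasure Q] (f : α → ℝ≥0∞) : ∫⁻ a, expNeg (f a) ∂Q ≠ ⊤ :=
  ((lintegral_mono fun _ => expNeg_le_one _).trans_lt (by simp)).ne

end ExpNeg

section PointMeasure

variable {ι Ω E : Type*} [MeasurableSpace E]

/-- The counting measure, with multiplicities, of a family of points. -/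
def pointMeasure (y : ι → E) : Measure E := Measure.sum fun i => Measure.dirac (y i)

lemma lintegral_pointMeasure (y : ι → E) {f : E → ℝ≥0∞} (hf : Measurable f) :
    ∫⁻ z, f z ∂(pointMeasure y) = ∑' i, f (y i) := by
  simp_rw [pointMeasure, lintegral_sum_measure, lintegral_dirac' _ hf]

lemma pointMeasure_apply (y : ι → E) {A : Set E} (hA : MeasurableSet A) :
    pointMeasure y A = ∑' i, A.indicator 1 (y i) := by
  simp_rw [pointMeasure, Measure.sum_apply _ hA, Measure.dirac_apply' _ hA]

lemma pointMeasure_eq_zero_iff (y : ι → E) {A : Set E} (hA : MeasurableSet A) :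
    pointMeasure y A = 0 ↔ ∀ i, y i ∉ A := by
  simp [pointMeasure_apply y hA]

@[fun_prop]
lemma measurable_pointMeasure [MeasurableSpace Ω] [Countable ι] {Y : ι → Ω → E}
    (hY : ∀ i, Measurable (Y i)) :
    Measurable fun ω => pointMeasure fun i => Y i ω := by
  refine Measure.measurable_of_measurable_coe _ fun A hA => ?_
  simp_rw [pointMeasure_apply _ hA]
  exact Measurable.tsum fun i => (measurable_one.indicator hA).comp (hY i)

lemma pointMeasure_eq_pointCount (X : ℕ → Ω → Plane) {A : Set Plane} (hA : MeasurableSet A)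
    (ω : Ω) : pointMeasure (fun n => X n ω) A = pointCount X A ω := by
  rw [pointMeasure_apply _ hA, pointCount, ← ENNReal.tsum_set_one,
    tsum_subtype {n | X n ω ∈ A} (fun _ => (1 : ℝ≥0∞))]
  rfl

end PointMeasure

section SimpleFunctions

variable {E : Type*} [MeasurableSpace E]

lemma lintegral_comp_simpleFunc (h : SimpleFunc E ℝ≥0∞) {g : ℝ≥0∞ → ℝ≥0∞} (hg : g 0 = 0)
    (μ : Measure E) :
    ∫⁻ x, g (h x) ∂μ = ∑ a : h.range.erase 0, g a * μ (h ⁻¹' {(a : ℝ≥0∞)}) := by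
  change ∫⁻ x, h.map g x ∂μ = _
  rw [SimpleFunc.lintegral_eq_lintegral, SimpleFunc.map_lintegral,
    Finset.sum_coe_sort (h.range.erase 0) fun a => g a * μ (h ⁻¹' {a}),
    Finset.sum_erase _ (by rw [hg, zero_mul])]

lemma exists_monotone_finMeasSupp_iSup_eq (μ : Measure E) [SigmaFinite μ] {h : E → ℝ≥0∞}
    (hh : Measurable h) :
    ∃ g : ℕ → SimpleFunc E ℝ≥0∞, (∀ x, Monotone fun j => g j x) ∧ (∀ x, ⨆ j, g j x = h x) ∧
      ∀ j, (g j).FinMeasSupp μ := by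
  have hS := measurableSet_spanningSets μ
  refine ⟨fun j => (SimpleFunc.eapprox h j).restrict (spanningSets μ j), fun x i j hij => ?_,
    fun x => le_antisymm (iSup_le fun j => ?_) ?_, fun j => ?_⟩
  · simp only [SimpleFunc.restrict_apply _ (hS _)]
    exact (indicator_le_indicator_of_subset (monotone_spanningSets μ hij)
      (fun _ => zero_le) x).trans (indicator_le_indicator (SimpleFunc.monotone_eapprox h hij x))
  · rw [SimpleFunc.restrict_apply _ (hS j), ← SimpleFunc.iSup_eapprox_apply hh x]
    exact (indicator_le_self _ _ _).trans (le_iSup (fun j => SimpleFunc.eapprox h j x) j)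
  · rw [← SimpleFunc.iSup_eapprox_apply hh x]
    refine iSup_le fun j => le_iSup_of_le (max j (spanningSetsIndex μ x)) ?_
    rw [SimpleFunc.restrict_apply _ (hS _), indicator_of_mem (monotone_spanningSets μ
      (le_max_right _ _) (mem_spanningSetsIndex μ x))]
    exact SimpleFunc.monotone_eapprox h (le_max_left _ _) x
  · refine SimpleFunc.finMeasSupp_iff.2 fun a ha =>
      (measure_mono fun x hx => ?_).trans_lt (measure_spanningSets_lt_top μ j)
    by_contra hxS
    refine ha ?_
    rw [← (hx : (SimpleFunc.eapprox h j).restrict (spanningSets μ j) x = a),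
      SimpleFunc.restrict_apply _ (hS j), indicator_of_notMem hxS]

end SimpleFunctions

/-- The points `Y 0, Y 1, …` form a Poisson process with intensity measure `μ`.  The process is
characterized by its Laplace functional, which makes thinning, marking and the Mecke formula
statements about a single integral identity. -/
structure IsPoissonProcess {Ω E : Type*} [MeasurableSpace Ω] [MeasurableSpace E]
    (P : Measure Ω) (μ : Measure E) (Y : ℕ → Ω → E) : Prop where
  measurable : ∀ n, Measurable (Y n)
  laplace : ∀ h : E → ℝ≥0∞, Measurable h →
    ∫⁻ ω, expNeg (∑' n, h (Y n ω)) ∂P = expNeg (∫⁻ y, (1 - expNeg (h y)) ∂μ)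

lemma IsPoissonProcess.of_laplace_simpleFunc {Ω E : Type*} [MeasurableSpace Ω]
    [MeasurableSpace E] {P : Measure Ω} [IsFiniteMeasure P] {μ : Measure E} [SigmaFinite μ]
    {Y : ℕ → Ω → E} (hY : ∀ n, Measurable (Y n))
    (hL : ∀ h : SimpleFunc E ℝ≥0∞, h.FinMeasSupp μ →
      ∫⁻ ω, expNeg (∑' n, h (Y n ω)) ∂P = expNeg (∫⁻ y, (1 - expNeg (h y)) ∂μ)) :
    IsPoissonProcess P μ Y := by
  refine ⟨hY, fun h hh => ?_⟩
  obtain ⟨g, hmono, hsup, hfin⟩ := exists_monotone_finMeasSupp_iSup_eq μ hh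
  have htend : ∀ x, Filter.Tendsto (fun j => g j x) Filter.atTop (nhds (h x)) := fun x =>
    hsup x ▸ tendsto_atTop_iSup (hmono x)
  have hleft : Filter.Tendsto (fun j => ∫⁻ ω, expNeg (∑' n, g j (Y n ω)) ∂P) Filter.atTop
      (nhds (∫⁻ ω, expNeg (∑' n, h (Y n ω)) ∂P)) := by
    refine tendsto_lintegral_expNeg
      (fun j => Measurable.tsum fun n => (g j).measurable.comp (hY n)) fun ω => ?_
    simp_rw [← lintegral_count]
    exact lintegral_tendsto_of_tendsto_of_monotone (fun j => measurable_from_top.aemeasurable)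
      (ae_of_all _ fun n => hmono (Y n ω)) (ae_of_all _ fun n => htend (Y n ω))
  have hright : Filter.Tendsto (fun j => expNeg (∫⁻ y, (1 - expNeg (g j y)) ∂μ)) Filter.atTop
      (nhds (expNeg (∫⁻ y, (1 - expNeg (h y)) ∂μ))) :=
    (continuous_expNeg.tendsto _).comp <| lintegral_tendsto_of_tendsto_of_monotone
      (fun j => (continuous_one_sub_expNeg.measurable.comp (g j).measurable).aemeasurable)
      (ae_of_all _ fun y _ _ hij => monotone_one_sub_expNeg (hmono y hij))
      (ae_of_all _ fun y => (continuous_one_sub_expNeg.tendsto _).comp (htend y))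
  exact tendsto_nhds_unique hleft (hright.congr fun j => (hL (g j) (hfin j)).symm)

section HomogeneousPPP

lemma lintegral_expNeg_mul_poissonMeasure (r : NNReal) (a : ℝ≥0∞) :
    ∫⁻ k, expNeg (a * (k : ℕ)) ∂(poissonMeasure r) = expNeg ((1 - expNeg a) * r) := by
  obtain ⟨x, hx0, hx1, hx⟩ : ∃ x : ℝ, 0 ≤ x ∧ x ≤ 1 ∧ expNeg a = ENNReal.ofReal x :=
    ⟨(expNeg a).toReal, ENNReal.toReal_nonneg,
      ENNReal.toReal_le_of_le_ofReal zero_le_one (by simpa using expNeg_le_one a),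
      (ENNReal.ofReal_toReal (expNeg_ne_top a)).symm⟩
  have hsum : HasSum (fun k : ℕ => Real.exp (-r) * ((x * r) ^ k / (k.factorial : ℝ)))
      (Real.exp (-r) * Real.exp (x * r)) := by
    rw [Real.exp_eq_exp_ℝ]
    exact (NormedSpace.expSeries_div_hasSum_exp (x * r : ℝ)).mul_left _
  have hterm : ∀ k : ℕ, expNeg (a * k) * poissonMeasure r {k} =
      ENNReal.ofReal (Real.exp (-r) * ((x * r) ^ k / (k.factorial : ℝ))) := fun k => by
    rw [expNeg_mul_natCast, poissonMeasure_singleton, hx, ← ENNReal.ofReal_pow hx0,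
      ← ENNReal.ofReal_mul (by positivity)]
    ring_nf
  calc ∫⁻ k, expNeg (a * (k : ℕ)) ∂(poissonMeasure r)
      = ENNReal.ofReal (Real.exp (-r) * Real.exp (x * r)) := by
        rw [lintegral_countable', tsum_congr hterm,
          ← ENNReal.ofReal_tsum_of_nonneg (fun k => by positivity) hsum.summable, hsum.tsum_eq]
    _ = expNeg (ENNReal.ofReal ((1 - x) * r)) := by
        rw [expNeg_ofReal (mul_nonneg (by linarith) r.coe_nonneg), ← Real.exp_add]
        ring_nf
    _ = expNeg ((1 - expNeg a) * r) := by
        rw [ENNReal.ofReal_mul (by linarith), ENNReal.ofReal_sub _ hx0, ENNReal.ofReal_one,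
          ENNReal.ofReal_coe_nnreal, hx]

namespace IsHomogeneousPPP

variable {Ω : Type*} [MeasurableSpace Ω] {P : Measure Ω} {lam : ℝ} {X : ℕ → Ω → Plane}

lemma measurable_pointCount (hX : IsHomogeneousPPP P lam X) {A : Set Plane}
    (hA : MeasurableSet A) : Measurable (pointCount X A) := by
  have hcount : Measurable fun ω => (pointCount X A ω : ℝ≥0∞) := by
    simp_rw [← pointMeasure_eq_pointCount X hA]
    exact (Measure.measurable_coe hA).comp (measurable_pointMeasure hX.measurable)
  refine ENat.measurable_iff.2 fun k => ?_
  convert hcount (measurableSet_singleton (k : ℝ≥0∞)) using 1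
  ext ω
  rw [mem_preimage, mem_preimage, mem_singleton_iff, mem_singleton_iff, ← ENat.toENNReal_coe,
    ENat.toENNReal_inj]

lemma map_pointCount [IsProbabilityMeasure P] (hX : IsHomogeneousPPP P lam X) {A : Set Plane}
    (hA : MeasurableSet A) (hAfin : volume A < ⊤) :
    P.map (pointCount X A) =
      (poissonMeasure (lam * (volume A).toReal).toNNReal).map (Nat.cast : ℕ → ℕ∞) := by
  have hm := hX.measurable_pointCount hA
  have hc : Measurable (Nat.cast : ℕ → ℕ∞) := measurable_from_top
  have := Measure.isProbabilityMeasure_map (μ := P) hm.aemeasurable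
  have := Measure.isProbabilityMeasure_map
    (μ := poissonMeasure (lam * (volume A).toReal).toNNReal) hc.aemeasurable
  have hnat : ∀ k : ℕ, P.map (pointCount X A) {(k : ℕ∞)} =
      (poissonMeasure (lam * (volume A).toReal).toNNReal).map Nat.cast {(k : ℕ∞)} := fun k => by
    rw [Measure.map_apply hm (measurableSet_singleton _),
      Measure.map_apply hc (measurableSet_singleton _)]
    have hpre : (Nat.cast : ℕ → ℕ∞) ⁻¹' {(k : ℕ∞)} = {k} := by ext; simp
    rw [hpre]
    exact hX.count_law A hA hAfin k
  have hrange : P.map (pointCount X A) (range Nat.cast) =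
      (poissonMeasure (lam * (volume A).toReal).toNNReal).map Nat.cast
        (range (Nat.cast : ℕ → ℕ∞)) := by
    rw [← iUnion_singleton_eq_range,
      measure_iUnion (fun i j hij => by simpa using hij) fun k => measurableSet_singleton _,
      measure_iUnion (fun i j hij => by simpa using hij) fun k => measurableSet_singleton _]
    exact tsum_congr hnat
  refine Measure.ext_of_singleton fun k => ?_
  induction k using ENat.recTopCoe with
  | coe k => exact hnat k
  | top =>
    have htop : ({⊤} : Set ℕ∞) = (range (Nat.cast : ℕ → ℕ∞))ᶜ := by simp [ENat.range_natCast]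
    rw [htop, prob_compl_eq_one_sub (countable_range _).measurableSet,
      prob_compl_eq_one_sub (countable_range _).measurableSet, hrange]

lemma lintegral_expNeg_mul_pointMeasure [IsProbabilityMeasure P] (hX : IsHomogeneousPPP P lam X)
    (hlam : 0 ≤ lam) {A : Set Plane} (hA : MeasurableSet A) (hAfin : volume A < ⊤) (a : ℝ≥0∞) :
    ∫⁻ ω, expNeg (a * pointMeasure (fun n => X n ω) A) ∂P =
      expNeg ((1 - expNeg a) * (ENNReal.ofReal lam * volume A)) := by
  have hf : Measurable fun k : ℕ∞ => expNeg (a * (k : ℝ≥0∞)) := measurable_from_top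
  simp_rw [pointMeasure_eq_pointCount X hA]
  rw [← lintegral_map hf (hX.measurable_pointCount hA), hX.map_pointCount hA hAfin,
    lintegral_map hf measurable_from_top]
  simp only [ENat.toENNReal_coe]
  rw [lintegral_expNeg_mul_poissonMeasure, ENNReal.ofNNReal_toNNReal, ENNReal.ofReal_mul hlam,
    ENNReal.ofReal_toReal hAfin.ne]

lemma lintegral_expNeg_sum_mul_pointMeasure [IsProbabilityMeasure P]
    (hX : IsHomogeneousPPP P lam X) (hlam : 0 ≤ lam) {ι : Type*} [Fintype ι] (a : ι → ℝ≥0∞)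
    {A : ι → Set Plane} (hA : ∀ i, MeasurableSet (A i)) (hAfin : ∀ i, volume (A i) < ⊤)
    (hd : Pairwise fun i j => Disjoint (A i) (A j)) :
    ∫⁻ ω, expNeg (∑ i, a i * pointMeasure (fun n => X n ω) (A i)) ∂P =
      expNeg (∑ i, (1 - expNeg (a i)) * (ENNReal.ofReal lam * volume (A i))) := by
  have hcount : iIndepFun (fun i => pointCount X (A i)) P := by
    let e := Fintype.equivFin ι
    simpa using (hX.count_indep _ (fun k => A (e.symm k)) (fun _ => hA _) (fun _ => hAfin _)
      (fun _ _ hij => hd (e.symm.injective.ne hij))).precomp e.injective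
  have hf : ∀ i, Measurable fun k : ℕ∞ => expNeg (a i * (k : ℝ≥0∞)) :=
    fun _ => measurable_from_top
  have hind : iIndepFun (fun i ω => expNeg (a i * pointMeasure (fun n => X n ω) (A i))) P := by
    simp_rw [fun i => pointMeasure_eq_pointCount X (hA i)]
    exact hcount.comp (fun i k => expNeg (a i * (k : ℝ≥0∞))) hf
  simp_rw [expNeg_sum]
  rw [lintegral_prod_eq_prod_lintegral_of_indepFun Finset.univ _ hind]
  · exact Finset.prod_congr rfl fun i _ =>
      hX.lintegral_expNeg_mul_pointMeasure hlam (hA i) (hAfin i) (a i)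
  · intro i
    simp_rw [pointMeasure_eq_pointCount X (hA i)]
    exact (hf i).comp (hX.measurable_pointCount (hA i))

theorem isPoissonProcess [IsProbabilityMeasure P] (hX : IsHomogeneousPPP P lam X)
    (hlam : 0 < lam) : IsPoissonProcess P (ENNReal.ofReal lam • volume) X := by
  have : SigmaFinite (ENNReal.ofReal lam • (volume : Measure Plane)) :=
    inferInstanceAs (SigmaFinite (lam.toNNReal • volume))
  refine .of_laplace_simpleFunc hX.measurable fun h hfin => ?_
  have hvol : ∀ a ≠ 0, volume (h ⁻¹' {a}) < ⊤ := fun a ha => by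
    refine ENNReal.lt_top_of_mul_ne_top_right ?_ (ENNReal.ofReal_pos.2 hlam).ne'
    simpa using (SimpleFunc.finMeasSupp_iff.1 hfin a ha).ne
  simp_rw [← lintegral_pointMeasure _ h.measurable]
  simp_rw [lintegral_comp_simpleFunc h (g := fun x => x) rfl]
  rw [lintegral_comp_simpleFunc h (g := fun x => 1 - expNeg x) (by simp)]
  simp only [Measure.smul_apply, smul_eq_mul]
  exact hX.lintegral_expNeg_sum_mul_pointMeasure hlam.le Subtype.val
    (fun a => h.measurableSet_preimage _) (fun a => hvol a (Finset.ne_of_mem_erase a.2))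
    fun a b hab => (disjoint_singleton.2 (Subtype.coe_injective.ne hab)).preimage _

end IsHomogeneousPPP

end HomogeneousPPP

section Marking

lemma lintegral_prodMk_of_indepFun {Ω α β : Type*} [MeasurableSpace Ω] [MeasurableSpace α]
    [MeasurableSpace β] {P : Measure Ω} [IsFiniteMeasure P] {f : Ω → α} {g : Ω → β}
    (hfg : IndepFun f g P) (hf : Measurable f) (hg : Measurable g) {φ : α × β → ℝ≥0∞}
    (hφ : Measurable φ) :
    ∫⁻ ω, φ (f ω, g ω) ∂P = ∫⁻ ω, ∫⁻ ω', φ (f ω, g ω') ∂P ∂P := by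
  rw [← lintegral_map hφ (hf.prodMk hg),
    (indepFun_iff_map_prod_eq_prod_map_map hf.aemeasurable hg.aemeasurable).1 hfg,
    lintegral_prod _ hφ.aemeasurable, lintegral_map hφ.lintegral_prod_right' hf]
  exact lintegral_congr fun ω => lintegral_map (hφ.comp measurable_prodMk_left) hg

namespace IsIndependentMarking

variable {Ω : Type*} [MeasurableSpace Ω] {P : Measure Ω} [IsProbabilityMeasure P]
  {X : ℕ → Ω → Plane} {M : Type*} [MeasurableSpace M] {ν : Measure M} {K : ℕ → Ω → M}

lemma isProbabilityMeasure (hK : IsIndependentMarking P X ν K) : IsProbabilityMeasure ν := by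
  rw [← hK.law 0]
  exact Measure.isProbabilityMeasure_map (hK.measurable 0).aemeasurable

lemma lintegral_expNeg_le_one (hK : IsIndependentMarking P X ν K) (f : M → ℝ≥0∞) :
    ∫⁻ m, expNeg (f m) ∂ν ≤ 1 := by
  have := hK.isProbabilityMeasure
  exact (lintegral_mono fun _ => expNeg_le_one _).trans (by simp)

lemma lintegral_expNeg_marks (hK : IsIndependentMarking P X ν K) {f : ℕ → M → ℝ≥0∞}
    (hf : ∀ n, Measurable (f n)) :
    ∫⁻ ω, expNeg (∑' n, f n (K n ω)) ∂P =
      expNeg (∑' n, negLog (∫⁻ m, expNeg (f n m) ∂ν)) := by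
  have hterm : ∀ n, Measurable fun m => expNeg (f n m) := fun n => measurable_expNeg.comp (hf n)
  have hfin : ∀ j, ∫⁻ ω, expNeg (∑ n ∈ Finset.range j, f n (K n ω)) ∂P =
      expNeg (∑ n ∈ Finset.range j, negLog (∫⁻ m, expNeg (f n m) ∂ν)) := fun j => by
    simp_rw [expNeg_sum]
    rw [lintegral_prod_eq_prod_lintegral_of_indepFun _ (fun n ω => expNeg (f n (K n ω)))
      (hK.iid.comp (fun n m => expNeg (f n m)) hterm) fun n => (hterm n).comp (hK.measurable n)]
    refine Finset.prod_congr rfl fun n _ => ?_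
    rw [expNeg_negLog (hK.lintegral_expNeg_le_one _), ← hK.law n,
      lintegral_map (hterm n) (hK.measurable n)]
  have hleft := tendsto_lintegral_expNeg (Q := P) (fun j => Finset.measurable_sum
    (Finset.range j) fun n _ => (hf n).comp (hK.measurable n)) fun ω => ENNReal.tendsto_nat_tsum _
  exact tendsto_nhds_unique hleft (((continuous_expNeg.tendsto _).comp
    (ENNReal.tendsto_nat_tsum _)).congr fun j => (hfin j).symm)

-- Conditionally on the points, the factor of a point `x` in the Laplace functional at `h` is
-- `∫ exp (-h (x, m)) dν(m)`.
theorem isPoissonProcess_prod (hK : IsIndependentMarking P X ν K) {μ : Measure Plane} [SFinite μ]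
    (hX : IsPoissonProcess P μ X) :
    IsPoissonProcess P (μ.prod ν) (fun n ω => (X n ω, K n ω)) := by
  have hν := hK.isProbabilityMeasure
  refine ⟨fun n => (hX.measurable n).prodMk (hK.measurable n), fun h hh => ?_⟩
  have hexp : Measurable fun y => expNeg (h y) := by fun_prop
  have hfactor : Measurable fun x => negLog (∫⁻ m, expNeg (h (x, m)) ∂ν) :=
    measurable_negLog.comp hexp.lintegral_prod_right'
  have hone : ∀ x, ∫⁻ m, (1 - expNeg (h (x, m))) ∂ν = 1 - ∫⁻ m, expNeg (h (x, m)) ∂ν :=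
    fun x => by
      rw [lintegral_sub (by fun_prop) (lintegral_expNeg_ne_top ν _)
        (ae_of_all _ fun m => expNeg_le_one _)]
      simp
  calc ∫⁻ ω, expNeg (∑' n, h (X n ω, K n ω)) ∂P
      = ∫⁻ ω, ∫⁻ ω', expNeg (∑' n, h (X n ω, K n ω')) ∂P ∂P :=
        lintegral_prodMk_of_indepFun hK.indep (measurable_pi_lambda _ hX.measurable)
          (measurable_pi_lambda _ hK.measurable)
          (φ := fun q => expNeg (∑' n, h (q.1 n, q.2 n))) (by fun_prop)
    _ = ∫⁻ ω, expNeg (∑' n, negLog (∫⁻ m, expNeg (h (X n ω, m)) ∂ν)) ∂P :=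
        lintegral_congr fun ω => hK.lintegral_expNeg_marks
          (f := fun n m => h (X n ω, m)) fun n => hh.comp measurable_prodMk_left
    _ = expNeg (∫⁻ x, (1 - ∫⁻ m, expNeg (h (x, m)) ∂ν) ∂μ) := by
        rw [hX.laplace _ hfactor]
        simp_rw [fun x => expNeg_negLog (hK.lintegral_expNeg_le_one fun m => h (x, m))]
    _ = expNeg (∫⁻ y, (1 - expNeg (h y)) ∂(μ.prod ν)) := by
        rw [lintegral_prod _ (by fun_prop)]
        simp_rw [hone]

end IsIndependentMarking

end Marking

section Moments

open BoundedContinuousFunction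

variable {ι : Type*} [Fintype ι]

/-- The `i`-th coordinate function on the cube `[0, 1]^ι`. -/
def cubeCoord (i : ι) : (ι → unitInterval) →ᵇ ℝ :=
  mkOfCompact ⟨fun x => (x i : ℝ), by fun_prop⟩

lemma exists_eq_prod_pow_of_mem_closure_cubeCoord {f : (ι → unitInterval) →ᵇ ℝ}
    (hf : f ∈ Submonoid.closure (range (cubeCoord (ι := ι)))) :
    ∃ k : ι → ℕ, ∀ x, f x = ∏ i, (x i : ℝ) ^ k i := by
  classical
  induction hf using Submonoid.closure_induction with
  | mem f hf =>
    obtain ⟨i, rfl⟩ := hf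
    refine ⟨Pi.single i 1, fun x => ?_⟩
    rw [Finset.prod_eq_single i (fun j _ hj => by simp [hj]) (by simp)]
    simp [cubeCoord]
  | one => exact ⟨0, fun x => by simp⟩
  | mul f g _ _ hf hg =>
    obtain ⟨k, hk⟩ := hf
    obtain ⟨l, hl⟩ := hg
    exact ⟨k + l, fun x => by simp [hk, hl, pow_add, Finset.prod_mul_distrib]⟩

lemma integral_eq_of_mem_adjoin_cubeCoord {Q₁ Q₂ : Measure (ι → unitInterval)}
    [IsFiniteMeasure Q₁] [IsFiniteMeasure Q₂]
    (h : ∀ k : ι → ℕ, ∫ x, ∏ i, (x i : ℝ) ^ k i ∂Q₁ = ∫ x, ∏ i, (x i : ℝ) ^ k i ∂Q₂)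
    {f : (ι → unitInterval) →ᵇ ℝ} (hf : f ∈ Algebra.adjoin ℝ (range cubeCoord)) :
    ∫ x, f x ∂Q₁ = ∫ x, f x ∂Q₂ := by
  rw [← Subalgebra.mem_toSubmodule, Algebra.adjoin_eq_span] at hf
  induction hf using Submodule.span_induction with
  | mem f hf =>
    obtain ⟨k, hk⟩ := exists_eq_prod_pow_of_mem_closure_cubeCoord hf
    simpa only [hk] using h k
  | zero => simp
  | add f g _ _ hf hg =>
    simp only [BoundedContinuousFunction.coe_add, Pi.add_apply]
    rw [integral_add (f.integrable _) (g.integrable _),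
      integral_add (f.integrable _) (g.integrable _), hf, hg]
  | smul c f _ hf =>
    simp only [BoundedContinuousFunction.coe_smul]
    rw [integral_smul, integral_smul, hf]

theorem measure_cube_ext_of_moments {Q₁ Q₂ : Measure (ι → unitInterval)} [IsFiniteMeasure Q₁]
    [IsFiniteMeasure Q₂]
    (h : ∀ k : ι → ℕ, ∫ x, ∏ i, (x i : ℝ) ^ k i ∂Q₁ = ∫ x, ∏ i, (x i : ℝ) ^ k i ∂Q₂) :
    Q₁ = Q₂ := by
  let A : StarSubalgebra ℝ ((ι → unitInterval) →ᵇ ℝ) :=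
    { Algebra.adjoin ℝ (range cubeCoord) with
      star_mem' := fun {f} hf => by
        rwa [show star f = f from BoundedContinuousFunction.ext fun x => rfl] }
  refine ext_of_forall_mem_subalgebra_integral_eq_of_polish (𝕜 := ℝ) (A := A)
    (fun x y hxy => ?_) fun f hf => integral_eq_of_mem_adjoin_cubeCoord h hf
  obtain ⟨i, hi⟩ := Function.ne_iff.1 hxy
  exact ⟨_, ⟨toContinuousMapStarₐ ℝ (cubeCoord i),
    ⟨cubeCoord i, Algebra.subset_adjoin ⟨i, rfl⟩, rfl⟩, rfl⟩, fun hc => hi (Subtype.ext hc)⟩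

end Moments

section LaplaceUniqueness

variable {E : Type*} [MeasurableSpace E]

/-- The map `ζ ↦ (exp (-ζ B))_B` that embeds the measures on `E` into a cube, so that uniqueness
of the moments of a law on the cube carries over to random measures. -/
def expNegCoord (ζ : Measure E) (B : {B : Set E // MeasurableSet B}) : unitInterval :=
  ⟨(expNeg (ζ B)).toReal, ENNReal.toReal_nonneg,
    ENNReal.toReal_le_of_le_ofReal zero_le_one (by simpa using expNeg_le_one _)⟩

lemma measurable_expNegCoord : Measurable (expNegCoord (E := E)) :=
  measurable_pi_lambda _ fun B => Measurable.subtype_mk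
    (measurable_expNeg.comp (Measure.measurable_coe B.2)).ennreal_toReal

lemma measurableSpace_eq_comap_expNegCoord :
    (Measure.instMeasurableSpace : MeasurableSpace (Measure E)) =
      MeasurableSpace.comap expNegCoord inferInstance := by
  refine le_antisymm (iSup₂_le fun B hB => ?_) measurable_expNegCoord.comap_le
  rw [← measurable_iff_comap_le]
  have hinv : (fun ζ : Measure E => ζ B) = (fun x : {B : Set E // MeasurableSet B} → unitInterval =>
      negLog (ENNReal.ofReal (x ⟨B, hB⟩))) ∘ expNegCoord := by
    ext ζ
    rw [Function.comp_apply, expNegCoord, ENNReal.ofReal_toReal (expNeg_ne_top _), negLog_expNeg]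
  rw [hinv]
  exact Measurable.comp (by fun_prop) (comap_measurable _)

lemma prod_expNegCoord_pow (ζ : Measure E) (I : Finset {B : Set E // MeasurableSet B})
    (k : I → ℕ) :
    ∏ B : I, (expNegCoord ζ B : ℝ) ^ k B =
      (expNeg (∫⁻ y, ∑ B : I, (B : Set E).indicator (fun _ => (k B : ℝ≥0∞)) y ∂ζ)).toReal := by
  rw [lintegral_finsetSum _ fun B _ => measurable_const.indicator B.1.2, expNeg_sum,
    ENNReal.toReal_prod]
  refine Finset.prod_congr rfl fun B _ => ?_
  rw [lintegral_indicator_const B.1.2, mul_comm, expNeg_mul_natCast, ENNReal.toReal_pow]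
  rfl

lemma integral_prod_pow_map_expNegCoord (Q : Measure (Measure E))
    (I : Finset {B : Set E // MeasurableSet B}) (k : I → ℕ) :
    ∫ x, ∏ B, (x B : ℝ) ^ k B ∂((Q.map expNegCoord).map I.restrict) =
      (∫⁻ ζ, expNeg (∫⁻ y, ∑ B : I, (B : Set E).indicator (fun _ => (k B : ℝ≥0∞)) y ∂ζ)
        ∂Q).toReal := by
  have hf : Measurable fun y => ∑ B : I, (B : Set E).indicator (fun _ => (k B : ℝ≥0∞)) y :=
    Finset.measurable_sum _ fun B _ => measurable_const.indicator B.1.2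
  have hζ : Measurable fun ζ : Measure E => expNeg
      (∫⁻ y, ∑ B : I, (B : Set E).indicator (fun _ => (k B : ℝ≥0∞)) y ∂ζ) :=
    measurable_expNeg.comp (Measure.measurable_lintegral hf)
  have hΦ : Measurable (I.restrict ∘ expNegCoord (E := E)) :=
    Measurable.comp (by fun_prop) measurable_expNegCoord
  have hcont : Continuous fun x : I → unitInterval => ∏ B, (x B : ℝ) ^ k B := by fun_prop
  rw [Measure.map_map (by fun_prop) measurable_expNegCoord,
    integral_map hΦ.aemeasurable hcont.aestronglyMeasurable,
    ← integral_toReal hζ.aemeasurable (ae_of_all _ fun _ => (expNeg_ne_top _).lt_top)]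
  exact integral_congr_ae (ae_of_all _ fun ζ => prod_expNegCoord_pow ζ I k)

theorem measure_ext_of_laplace {Q₁ Q₂ : Measure (Measure E)} [IsFiniteMeasure Q₁]
    [IsFiniteMeasure Q₂]
    (h : ∀ f : E → ℝ≥0∞, Measurable f → (∀ y, f y ≠ ⊤) →
      ∫⁻ ζ, expNeg (∫⁻ y, f y ∂ζ) ∂Q₁ = ∫⁻ ζ, expNeg (∫⁻ y, f y ∂ζ) ∂Q₂) :
    Q₁ = Q₂ := by
  have hcube : Q₁.map expNegCoord = Q₂.map expNegCoord := by
    refine IsProjectiveLimit.unique (P := fun I => (Q₂.map expNegCoord).map I.restrict)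
      (fun I => measure_cube_ext_of_moments fun k => ?_) fun I => rfl
    rw [integral_prod_pow_map_expNegCoord, integral_prod_pow_map_expNegCoord, h _
      (Finset.measurable_sum _ fun B _ => measurable_const.indicator B.1.2)
      fun y => ENNReal.sum_ne_top.2 fun B _ =>
        ne_top_of_le_ne_top (ENNReal.natCast_ne_top _) (indicator_le_self _ _ y)]
  ext s hs
  rw [measurableSpace_eq_comap_expNegCoord] at hs
  obtain ⟨t, ht, rfl⟩ := hs
  rw [← Measure.map_apply measurable_expNegCoord ht, hcube,
    Measure.map_apply measurable_expNegCoord ht]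

end LaplaceUniqueness

section OneSubExpNeg

lemma one_sub_expNeg_le (x : ℝ≥0∞) : 1 - expNeg x ≤ x := by
  by_cases hx : x = ⊤
  · simp [hx]
  · lift x to NNReal using hx
    rw [← ENNReal.ofReal_coe_nnreal, expNeg_ofReal x.coe_nonneg, ← ENNReal.ofReal_one,
      ← ENNReal.ofReal_sub _ (Real.exp_pos _).le]
    exact ENNReal.ofReal_le_ofReal (by linarith [Real.add_one_le_exp (-(x : ℝ))])

-- The bound is `x / (1 + x) ≤ 1 - exp (-x)`, written so that it stays sharp at `x = ∞`.
lemma inv_one_add_inv_le_one_sub_expNeg (x : ℝ≥0∞) : (1 + x⁻¹)⁻¹ ≤ 1 - expNeg x := by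
  by_cases hx : x = ⊤
  · simp [hx]
  by_cases hx₀ : x = 0
  · simp [hx₀]
  obtain ⟨t, ht, rfl⟩ : ∃ t : ℝ, 0 < t ∧ x = ENNReal.ofReal t :=
    ⟨x.toReal, ENNReal.toReal_pos hx₀ hx, (ENNReal.ofReal_toReal hx).symm⟩
  rw [expNeg_ofReal ht.le, ← ENNReal.ofReal_inv_of_pos ht, ← ENNReal.ofReal_one,
    ← ENNReal.ofReal_add zero_le_one (by positivity), ← ENNReal.ofReal_inv_of_pos (by positivity),
    ← ENNReal.ofReal_sub _ (Real.exp_pos _).le]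
  refine ENNReal.ofReal_le_ofReal ?_
  have hexp : Real.exp (-t) ≤ (1 + t)⁻¹ := by
    rw [Real.exp_neg]
    exact inv_anti₀ (by positivity) (by linarith [Real.add_one_le_exp t])
  have hinv : (1 + t⁻¹)⁻¹ = 1 - (1 + t)⁻¹ := by
    field_simp
    ring
  linarith

lemma natCast_mul_one_sub_expNeg_div_le (n : ℕ) (x : ℝ≥0∞) :
    n * (1 - expNeg (x / n)) ≤ x :=
  (mul_le_mul_right (one_sub_expNeg_le _) _).trans ENNReal.mul_div_le

lemma tendsto_natCast_mul_one_sub_expNeg {x : ℕ → ℝ≥0∞} {b : ℝ≥0∞}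
    (hx : Filter.Tendsto x Filter.atTop (nhds b)) :
    Filter.Tendsto (fun n : ℕ => n * (1 - expNeg (x n / n))) Filter.atTop (nhds b) := by
  have hlower : Filter.Tendsto (fun n : ℕ => ((n : ℝ≥0∞)⁻¹ + (x n)⁻¹)⁻¹) Filter.atTop
      (nhds b) := by
    simpa using (ENNReal.tendsto_inv_nat_nhds_zero.add hx.inv).inv
  refine tendsto_of_tendsto_of_tendsto_of_le_of_le' hlower hx ?_
    (Filter.Eventually.of_forall fun n => natCast_mul_one_sub_expNeg_div_le n _)
  filter_upwards [Filter.eventually_ne_atTop 0] with n hn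
  have hn' : (n : ℝ≥0∞) ≠ 0 := Nat.cast_ne_zero.2 hn
  calc ((n : ℝ≥0∞)⁻¹ + (x n)⁻¹)⁻¹ = ((n : ℝ≥0∞)⁻¹ * (1 + (x n / n)⁻¹))⁻¹ := by
        rw [ENNReal.inv_div (by simp) (by simp [hn]), mul_add, mul_one, div_eq_mul_inv, ← mul_assoc,
          ENNReal.inv_mul_cancel hn' (by simp), one_mul]
    _ = n * (1 + (x n / n)⁻¹)⁻¹ := by
        rw [ENNReal.mul_inv (Or.inl (by simp)) (Or.inl (by simp [hn])), inv_inv]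
    _ ≤ n * (1 - expNeg (x n / n)) := by gcongr; exact inv_one_add_inv_le_one_sub_expNeg _

lemma tendsto_natCast_mul_lintegral_one_sub_expNeg {α : Type*} [MeasurableSpace α] (Q : Measure α)
    {f : α → ℝ≥0∞} (hf : Measurable f) :
    Filter.Tendsto (fun n : ℕ => n * ∫⁻ x, (1 - expNeg (f x / n)) ∂Q) Filter.atTop
      (nhds (∫⁻ x, f x ∂Q)) := by
  simp_rw [← lintegral_const_mul' _ _ (ENNReal.natCast_ne_top _)]
  refine tendsto_of_le_liminf_of_limsup_le ?_ ?_
  · calc ∫⁻ x, f x ∂Q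
        = ∫⁻ x, Filter.liminf (fun n : ℕ => n * (1 - expNeg (f x / n))) Filter.atTop ∂Q :=
          lintegral_congr fun x =>
            (tendsto_natCast_mul_one_sub_expNeg tendsto_const_nhds).liminf_eq.symm
      _ ≤ _ := lintegral_liminf_le fun n => by fun_prop
  · exact Filter.limsup_le_of_le (h := Filter.Eventually.of_forall fun n =>
      lintegral_mono fun x => natCast_mul_one_sub_expNeg_div_le n (f x))

end OneSubExpNeg

namespace IsPoissonProcess

variable {Ω E : Type*} [MeasurableSpace Ω] [MeasurableSpace E] {P : Measure Ω}
  {μ : Measure E} {Y : ℕ → Ω → E}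

lemma measurable_tsum (hY : IsPoissonProcess P μ Y) {g : E → ℝ≥0∞} (hg : Measurable g) :
    Measurable fun ω => ∑' n, g (Y n ω) :=
  Measurable.tsum fun n => hg.comp (hY.measurable n)

lemma measurable_expNeg_tsum (hY : IsPoissonProcess P μ Y) {h : E → ℝ≥0∞} (hh : Measurable h) :
    Measurable fun ω => expNeg (∑' n, h (Y n ω)) :=
  measurable_expNeg.comp (hY.measurable_tsum hh)

lemma isProbabilityMeasure (hY : IsPoissonProcess P μ Y) : IsProbabilityMeasure P :=
  ⟨by simpa using hY.laplace (fun _ => 0) measurable_const⟩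

lemma measure_void (hY : IsPoissonProcess P μ Y) {B : Set E} (hB : MeasurableSet B) :
    P {ω | ∀ k, Y k ω ∉ B} = expNeg (μ B) := by
  have hvoid : MeasurableSet {ω | ∀ k, Y k ω ∉ B} := by
    rw [ofPred_forall]
    exact MeasurableSet.iInter fun k => (hY.measurable k hB).compl
  have hμ : ∫⁻ y, (1 - expNeg (B.indicator (fun _ => ⊤) y)) ∂μ = μ B := by
    rw [← lintegral_indicator_one hB]
    refine lintegral_congr fun y => ?_
    by_cases hy : y ∈ B <;> simp [hy]
  rw [← hμ, ← hY.laplace _ (measurable_const.indicator hB), ← lintegral_indicator_one hvoid]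
  refine lintegral_congr fun ω => ?_
  by_cases hω : ∀ k, Y k ω ∉ B
  · rw [indicator_of_mem (mem_ofPred_eq ▸ hω),
      ENNReal.tsum_eq_zero.2 fun k => indicator_of_notMem (hω k) _]
    simp
  · rw [indicator_of_notMem (s := {ω | ∀ k, Y k ω ∉ B}) hω]
    push Not at hω
    obtain ⟨k, hk⟩ := hω
    rw [ENNReal.tsum_eq_top_of_eq_top ⟨k, by simp [hk]⟩, expNeg_top]

-- Compare the two sides of the Laplace identity at `g / n` as `n → ∞`.
theorem campbell (hY : IsPoissonProcess P μ Y) {g : E → ℝ≥0∞} (hg : Measurable g) :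
    ∫⁻ ω, ∑' n, g (Y n ω) ∂P = ∫⁻ y, g y ∂μ := by
  have := hY.isProbabilityMeasure
  have hsum := hY.measurable_tsum hg
  have hlaplace : ∀ n : ℕ, ∫⁻ ω, (1 - expNeg ((∑' k, g (Y k ω)) / n)) ∂P =
      1 - expNeg (∫⁻ y, (1 - expNeg (g y / n)) ∂μ) := fun n => by
    rw [lintegral_sub (by fun_prop) (lintegral_expNeg_ne_top P _)
      (ae_of_all _ fun ω => expNeg_le_one _), lintegral_one, measure_univ,
      ← hY.laplace (fun y => g y / n) (by fun_prop)]
    simp_rw [div_eq_mul_inv, ENNReal.tsum_mul_right]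
  refine tendsto_nhds_unique (tendsto_natCast_mul_lintegral_one_sub_expNeg P hsum)
    ((tendsto_natCast_mul_one_sub_expNeg
      (tendsto_natCast_mul_lintegral_one_sub_expNeg μ hg)).congr' ?_)
  filter_upwards [Filter.eventually_ne_atTop 0] with n hn
  rw [hlaplace, mul_comm (n : ℝ≥0∞) (∫⁻ _, _ ∂μ),
    ENNReal.mul_div_cancel_right (Nat.cast_ne_zero.2 hn) (ENNReal.natCast_ne_top n)]

-- The tilt turns Campbell's formula into Mecke's formula for product functionals.
lemma tilt (hY : IsPoissonProcess P μ Y) {h : E → ℝ≥0∞} (hh : Measurable h)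
    (hL : ∫⁻ y, (1 - expNeg (h y)) ∂μ ≠ ⊤) :
    IsPoissonProcess
      ((expNeg (∫⁻ y, (1 - expNeg (h y)) ∂μ))⁻¹ •
        P.withDensity fun ω => expNeg (∑' n, h (Y n ω)))
      (μ.withDensity fun y => expNeg (h y)) Y := by
  refine ⟨hY.measurable, fun k hk => ?_⟩
  have hsplit : ∫⁻ y, (1 - expNeg (h y + k y)) ∂μ = ∫⁻ y, (1 - expNeg (h y)) ∂μ +
      ∫⁻ y, expNeg (h y) * (1 - expNeg (k y)) ∂μ := by
    rw [← lintegral_add_left (by fun_prop)]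
    refine lintegral_congr fun y => ?_
    rw [expNeg_add, ENNReal.mul_sub fun _ _ => expNeg_ne_top _, mul_one,
      tsub_add_tsub_cancel (expNeg_le_one _) (mul_le_of_le_one_right' (expNeg_le_one _))]
  rw [lintegral_smul_measure, smul_eq_mul,
    lintegral_withDensity_eq_lintegral_mul _ (hY.measurable_expNeg_tsum hh)
      (hY.measurable_expNeg_tsum hk),
    lintegral_withDensity_eq_lintegral_mul _ (by fun_prop) (by fun_prop)]
  simp_rw [Pi.mul_apply, ← expNeg_add, ← ENNReal.tsum_add]
  rw [hY.laplace (fun y => h y + k y) (hh.add hk), hsplit, expNeg_add, ← mul_assoc,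
    ENNReal.inv_mul_cancel (mt expNeg_eq_zero.1 hL) (expNeg_ne_top _), one_mul]

theorem lintegral_expNeg_tsum_mul_tsum (hY : IsPoissonProcess P μ Y) {g h : E → ℝ≥0∞}
    (hg : Measurable g) (hh : Measurable h) :
    ∫⁻ ω, expNeg (∑' k, h (Y k ω)) * ∑' n, g (Y n ω) ∂P =
      expNeg (∫⁻ y, (1 - expNeg (h y)) ∂μ) * ∫⁻ y, expNeg (h y) * g y ∂μ := by
  have hexp := hY.measurable_expNeg_tsum hh
  by_cases hL : ∫⁻ y, (1 - expNeg (h y)) ∂μ = ⊤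
  · have hzero : (fun ω => expNeg (∑' k, h (Y k ω))) =ᵐ[P] 0 := by
      rw [← lintegral_eq_zero_iff hexp, hY.laplace h hh, hL, expNeg_top]
    rw [hL, expNeg_top, zero_mul, lintegral_congr_ae (g := 0) ?_, lintegral_zero_fun]
    filter_upwards [hzero] with ω hω
    simp only [hω, Pi.zero_apply, zero_mul]
  · have hcampbell := (hY.tilt hh hL).campbell hg
    rw [lintegral_smul_measure, smul_eq_mul,
      lintegral_withDensity_eq_lintegral_mul _ hexp (hY.measurable_tsum hg),
      lintegral_withDensity_eq_lintegral_mul _ (by fun_prop) hg] at hcampbell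
    simp only [Pi.mul_apply] at hcampbell
    rw [← hcampbell, ← mul_assoc,
      ENNReal.mul_inv_cancel (mt expNeg_eq_zero.1 hL) (expNeg_ne_top _), one_mul]

end IsPoissonProcess

section WeightedKernel

variable {E : Type*} [MeasurableSpace E]

/-- The kernel sending a measure `ζ` to the probability measure proportional to `w • ζ`, or to `0`
if `∫ w dζ` is `0` or `∞`.  Being finite even though `ζ` is arbitrary, it makes
`{(y, ζ) | ζ B_y = 0}` measurable, up to the measures with `∫ w dζ = ∞`, when `B_y` varies
measurably. -/
def weightedKernel (w : E → ℝ≥0∞) (hw : Measurable w) : Kernel (Measure E) E where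
  toFun ζ := (∫⁻ z, w z ∂ζ)⁻¹ • ζ.withDensity w
  measurable' := by
    refine Measure.measurable_of_measurable_coe _ fun A hA => ?_
    simp_rw [Measure.smul_apply, withDensity_apply _ hA, ← lintegral_indicator hA]
    exact (Measure.measurable_lintegral hw).inv.mul
      (Measure.measurable_lintegral (hw.indicator hA))

lemma weightedKernel_apply {w : E → ℝ≥0∞} (hw : Measurable w) (ζ : Measure E) :
    weightedKernel w hw ζ = (∫⁻ z, w z ∂ζ)⁻¹ • ζ.withDensity w := rfl

instance {w : E → ℝ≥0∞} {hw : Measurable w} : IsFiniteKernel (weightedKernel w hw) := by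
  refine ⟨⟨1, ENNReal.one_lt_top, fun ζ => ?_⟩⟩
  rw [weightedKernel_apply, Measure.smul_apply, withDensity_apply _ MeasurableSet.univ,
    Measure.restrict_univ]
  exact ENNReal.inv_mul_le_one _

lemma weightedKernel_apply_eq_zero_iff {w : E → ℝ≥0∞} (hw : Measurable w) (hw₀ : ∀ z, w z ≠ 0)
    {ζ : Measure E} (hζ : ∫⁻ z, w z ∂ζ ≠ ⊤) (A : Set E) :
    weightedKernel w hw ζ A = 0 ↔ ζ A = 0 := by
  rw [weightedKernel_apply, Measure.smul_apply, smul_eq_mul, mul_eq_zero,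
    withDensity_apply_eq_zero hw]
  simp [hζ, hw₀]

lemma measurable_weightedKernel_section {w : E → ℝ≥0∞} (hw : Measurable w) {B : Set (E × E)}
    (hB : MeasurableSet B) :
    Measurable fun q : E × Measure E => weightedKernel w hw q.2 (Prod.mk q.1 ⁻¹' B) := by
  have hB' : MeasurableSet {q : (E × Measure E) × E | (q.1.1, q.2) ∈ B} :=
    (show Measurable fun q : (E × Measure E) × E => (q.1.1, q.2) by fun_prop) hB
  simpa only [Kernel.prodMkLeft_apply] using!
    Kernel.measurable_kernel_prodMk_left (κ := Kernel.prodMkLeft E (weightedKernel w hw)) hB'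

end WeightedKernel

lemma measure_ext_of_sigmaFinite {E : Type*} [MeasurableSpace E] (μ : Measure E) [SigmaFinite μ]
    {m₁ m₂ : Measure E} (h : ∀ A, MeasurableSet A → μ A ≠ ⊤ → m₁ A = m₂ A) : m₁ = m₂ := by
  rw [Measure.ext_iff_of_iUnion_eq_univ (iUnion_spanningSets μ)]
  refine fun i => Measure.ext fun A hA => ?_
  rw [Measure.restrict_apply hA, Measure.restrict_apply hA]
  exact h _ (hA.inter (measurableSet_spanningSets μ i))
    ((measure_mono inter_subset_right).trans_lt (measure_spanningSets_lt_top μ i)).ne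

section PointMeasureErase

variable {E : Type*} [MeasurableSpace E]

/-- The counting measure of the points `y 0, y 1, …` other than the `n`-th. -/
def pointMeasureErase (n : ℕ) (y : ℕ → E) : Measure E := pointMeasure fun k : {k // k ≠ n} => y k

lemma lintegral_pointMeasureErase (n : ℕ) (y : ℕ → E) {f : E → ℝ≥0∞} (hf : Measurable f) :
    ∫⁻ z, f z ∂(pointMeasureErase n y) = ∑' k : {k // k ≠ n}, f (y k) :=
  lintegral_pointMeasure _ hf

lemma lintegral_pointMeasureErase_le (n : ℕ) (y : ℕ → E) {f : E → ℝ≥0∞} (hf : Measurable f) :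
    ∫⁻ z, f z ∂(pointMeasureErase n y) ≤ ∑' k, f (y k) :=
  (lintegral_pointMeasureErase n y hf).trans_le
    (ENNReal.tsum_comp_le_tsum_of_injective Subtype.val_injective fun k => f (y k))

lemma add_lintegral_pointMeasureErase (n : ℕ) (y : ℕ → E) {f : E → ℝ≥0∞} (hf : Measurable f) :
    f (y n) + ∫⁻ z, f z ∂(pointMeasureErase n y) = ∑' k, f (y k) := by
  rw [lintegral_pointMeasureErase n y hf, ← tsum_singleton n fun k => f (y k)]
  exact ENNReal.summable.tsum_add_tsum_compl (f := fun k => f (y k)) (s := {n}) ENNReal.summable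

lemma pointMeasureErase_eq_zero_iff (n : ℕ) (y : ℕ → E) {A : Set E} (hA : MeasurableSet A) :
    pointMeasureErase n y A = 0 ↔ ∀ k, k ≠ n → y k ∉ A := by
  simp [pointMeasureErase, pointMeasure_eq_zero_iff _ hA]

end PointMeasureErase

namespace IsPoissonProcess

variable {Ω E : Type*} [MeasurableSpace Ω] [MeasurableSpace E] {P : Measure Ω} {μ : Measure E}
  {Y : ℕ → Ω → E}

lemma measurable_pointMeasure (hY : IsPoissonProcess P μ Y) :
    Measurable fun ω => pointMeasure fun k => Y k ω :=
  _root_.measurable_pointMeasure hY.measurable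

lemma measurable_pointMeasureErase (hY : IsPoissonProcess P μ Y) (n : ℕ) :
    Measurable fun ω => pointMeasureErase n fun k => Y k ω :=
  _root_.measurable_pointMeasure fun k => hY.measurable k

-- Apply Mecke's formula to `g = 𝟙_A / exp (-h)`, whose factor at the `n`-th point cancels the
-- contribution of that point to `exp (-∑ h)`.
lemma tsum_setLIntegral_expNeg_erase (hY : IsPoissonProcess P μ Y) {h : E → ℝ≥0∞}
    (hh : Measurable h) (hfin : ∀ y, h y ≠ ⊤) {A : Set E} (hA : MeasurableSet A) :
    ∑' n, ∫⁻ ω in Y n ⁻¹' A, expNeg (∫⁻ z, h z ∂(pointMeasureErase n fun k => Y k ω)) ∂P =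
      μ A * ∫⁻ ω, expNeg (∫⁻ z, h z ∂(pointMeasure fun k => Y k ω)) ∂P := by
  have hcancel : ∀ y, expNeg (h y) * (expNeg (h y))⁻¹ = 1 := fun y =>
    ENNReal.mul_inv_cancel (mt expNeg_eq_zero.1 (hfin y)) (expNeg_ne_top _)
  set g : E → ℝ≥0∞ := A.indicator fun y => (expNeg (h y))⁻¹ with hg
  have hgm : Measurable g := Measurable.indicator (by fun_prop) hA
  have hμ : ∫⁻ y, expNeg (h y) * g y ∂μ = μ A := by
    rw [← lintegral_indicator_one hA]
    refine lintegral_congr fun y => ?_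
    by_cases hy : y ∈ A <;> simp [hg, hy, hcancel]
  have herase : ∀ n ω, (Y n ⁻¹' A).indicator
      (fun ω => expNeg (∫⁻ z, h z ∂(pointMeasureErase n fun k => Y k ω))) ω =
        expNeg (∑' k, h (Y k ω)) * g (Y n ω) := fun n ω => by
    by_cases hω : Y n ω ∈ A
    · rw [indicator_of_mem (mem_preimage.2 hω), hg, indicator_of_mem hω,
        ← add_lintegral_pointMeasureErase n (fun k => Y k ω) hh, expNeg_add, mul_right_comm,
        hcancel, one_mul]
    · rw [indicator_of_notMem (mt mem_preimage.1 hω), hg, indicator_of_notMem hω, mul_zero]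
  simp_rw [lintegral_pointMeasure _ hh]
  rw [hY.laplace h hh, mul_comm, ← hμ, ← hY.lintegral_expNeg_tsum_mul_tsum hgm hh]
  simp_rw [← ENNReal.tsum_mul_left]
  rw [lintegral_tsum (f := fun n ω => expNeg (∑' k, h (Y k ω)) * g (Y n ω)) fun n =>
    ((hY.measurable_expNeg_tsum hh).mul (hgm.comp (hY.measurable n))).aemeasurable]
  exact tsum_congr fun n => by
    rw [← lintegral_indicator (hY.measurable n hA)]
    exact lintegral_congr (herase n)

lemma sum_map_restrict_pointMeasureErase (hY : IsPoissonProcess P μ Y) {A : Set E}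
    (hA : MeasurableSet A) (hμA : μ A ≠ ⊤) :
    Measure.sum (fun n => (P.restrict (Y n ⁻¹' A)).map
        fun ω => pointMeasureErase n fun k => Y k ω) =
      μ A • P.map fun ω => pointMeasure fun k => Y k ω := by
  have := hY.isProbabilityMeasure
  set Q := Measure.sum fun n => (P.restrict (Y n ⁻¹' A)).map
    fun ω => pointMeasureErase n fun k => Y k ω with hQ
  have hlaplace : ∀ f : E → ℝ≥0∞, Measurable f → (∀ y, f y ≠ ⊤) →
      ∫⁻ ζ, expNeg (∫⁻ y, f y ∂ζ) ∂Q =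
        ∫⁻ ζ, expNeg (∫⁻ y, f y ∂ζ) ∂(μ A • P.map fun ω => pointMeasure fun k => Y k ω) := by
    intro f hf hfin
    have hζ : Measurable fun ζ : Measure E => expNeg (∫⁻ y, f y ∂ζ) :=
      measurable_expNeg.comp (Measure.measurable_lintegral hf)
    rw [hQ, lintegral_sum_measure, lintegral_smul_measure, smul_eq_mul,
      lintegral_map hζ hY.measurable_pointMeasure, ← hY.tsum_setLIntegral_expNeg_erase hf hfin hA]
    exact tsum_congr fun n => lintegral_map hζ (hY.measurable_pointMeasureErase n)
  have hfinite : IsFiniteMeasure (μ A • P.map fun ω => pointMeasure fun k => Y k ω) :=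
    Measure.smul_finite _ hμA
  have : IsFiniteMeasure Q := by
    refine ⟨?_⟩
    have hmass := hlaplace (fun _ => 0) measurable_const (by simp)
    simp only [lintegral_zero, expNeg_zero, lintegral_one] at hmass
    exact hmass ▸ measure_lt_top _ _
  exact measure_ext_of_laplace hlaplace

theorem slivnyak_mecke [SigmaFinite μ] (hY : IsPoissonProcess P μ Y) :
    Measure.sum (fun n => P.map fun ω => (Y n ω, pointMeasureErase n fun k => Y k ω)) =
      μ.prod (P.map fun ω => pointMeasure fun k => Y k ω) := by
  have := hY.isProbabilityMeasure
  have hζ := hY.measurable_pointMeasure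
  have hη := hY.measurable_pointMeasureErase
  have := Measure.isProbabilityMeasure_map (μ := P) hζ.aemeasurable
  refine (Measure.prod_eq fun A T hA hT => ?_).symm
  have hproj : Measure.sum (fun n =>
      (P.restrict ((fun ω => pointMeasureErase n fun k => Y k ω) ⁻¹' T)).map (Y n)) =
        (P.map fun ω => pointMeasure fun k => Y k ω) T • μ := by
    refine measure_ext_of_sigmaFinite μ fun A hA hμA => ?_
    rw [Measure.smul_apply, smul_eq_mul, mul_comm, ← smul_eq_mul, ← Measure.smul_apply,
      ← hY.sum_map_restrict_pointMeasureErase hA hμA, Measure.sum_apply _ hA,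
      Measure.sum_apply _ hT]
    refine tsum_congr fun n => ?_
    rw [Measure.map_apply (hY.measurable n) hA, Measure.map_apply (hη n) hT,
      Measure.restrict_apply (hY.measurable n hA), Measure.restrict_apply (hη n hT), inter_comm]
  rw [mul_comm, ← smul_eq_mul, ← Measure.smul_apply, ← hproj, Measure.sum_apply _ hA,
    Measure.sum_apply _ (hA.prod hT)]
  refine tsum_congr fun n => ?_
  rw [Measure.map_apply (hY.measurable n) hA, Measure.restrict_apply (hY.measurable n hA),
    Measure.map_apply ((hY.measurable n).prodMk (hη n)) (hA.prod hT)]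
  rfl

lemma exists_measurableSet_void [SigmaFinite μ] (hY : IsPoissonProcess P μ Y) {B : Set (E × E)}
    (hB : MeasurableSet B) :
    ∃ T : Set (E × Measure E), MeasurableSet T ∧
      (∀ᵐ ω ∂P, ∀ n, (Y n ω, pointMeasureErase n fun k => Y k ω) ∈ T ↔
        ∀ k, k ≠ n → (Y n ω, Y k ω) ∉ B) ∧
      ∀ y, (P.map fun ω => pointMeasure fun k => Y k ω) (Prod.mk y ⁻¹' T) =
        expNeg (μ (Prod.mk y ⁻¹' B)) := by
  obtain ⟨w, hw₀, hw, hwμ⟩ := exists_pos_lintegral_lt_of_sigmaFinite μ one_ne_zero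
  have hw' : Measurable fun z => (w z : ℝ≥0∞) := by fun_prop
  have hzero {ζ : Measure E} := weightedKernel_apply_eq_zero_iff hw'
    (fun z => by simpa using (hw₀ z).ne') (ζ := ζ)
  have hsec : ∀ y, MeasurableSet (Prod.mk y ⁻¹' B) := fun y => measurable_prodMk_left hB
  have hfin : ∀ᵐ ω ∂P, ∑' k, (w (Y k ω) : ℝ≥0∞) ≠ ⊤ :=
    (ae_lt_top (hY.measurable_tsum hw') (hY.campbell hw' ▸ hwμ.ne_top)).mono fun _ h => h.ne
  have hT := measurable_weightedKernel_section hw' hB (measurableSet_singleton 0)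
  refine ⟨_, hT, ?_, fun y => ?_⟩
  · filter_upwards [hfin] with ω hω n
    exact (hzero ((lintegral_pointMeasureErase_le n _ hw').trans_lt hω.lt_top).ne _).trans
      (pointMeasureErase_eq_zero_iff n (fun k => Y k ω) (hsec _))
  · rw [Measure.map_apply hY.measurable_pointMeasure (measurable_prodMk_left hT),
      ← hY.measure_void (hsec y)]
    refine measure_congr ?_
    filter_upwards [hfin] with ω hω
    refine propext (Iff.trans ?_ (pointMeasure_eq_zero_iff (fun k => Y k ω) (hsec y)))
    exact hzero ((lintegral_pointMeasure _ hw').trans_ne hω) _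

theorem tsum_measure_mem_and_void [SigmaFinite μ] (hY : IsPoissonProcess P μ Y) {C : Set E}
    (hC : MeasurableSet C) {B : Set (E × E)} (hB : MeasurableSet B) :
    ∑' n, P {ω | Y n ω ∈ C ∧ ∀ k, k ≠ n → (Y n ω, Y k ω) ∉ B} =
      ∫⁻ y in C, expNeg (μ (Prod.mk y ⁻¹' B)) ∂μ := by
  have := hY.isProbabilityMeasure
  have := Measure.isProbabilityMeasure_map (μ := P) hY.measurable_pointMeasure.aemeasurable
  obtain ⟨T, hT, hvoid, hsec⟩ := hY.exists_measurableSet_void hB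
  have hCT : MeasurableSet (Prod.fst ⁻¹' C ∩ T) := (measurable_fst hC).inter hT
  have hcampbell := congrArg (fun m => m (Prod.fst ⁻¹' C ∩ T)) hY.slivnyak_mecke
  simp only [Measure.sum_apply _ hCT, Measure.prod_apply hCT] at hcampbell
  rw [← lintegral_indicator hC]
  refine Eq.trans (tsum_congr fun n => ?_) (hcampbell.trans (lintegral_congr fun y => ?_))
  · rw [Measure.map_apply ((hY.measurable n).prodMk (hY.measurable_pointMeasureErase n)) hCT]
    refine measure_congr ?_
    filter_upwards [hvoid] with ω hω
    exact propext (and_congr_right fun _ => (hω n).symm)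
  · by_cases hy : y ∈ C
    · rw [indicator_of_mem hy, ← hsec, preimage_inter, ← preimage_comp]
      simp [hy, Function.comp_def]
    · rw [indicator_of_notMem hy, preimage_inter, ← preimage_comp]
      simp [hy, Function.comp_def]

lemma ae_notMem (hY : IsPoissonProcess P μ Y) {A : Set E} (hA : MeasurableSet A)
    (hμA : μ A = 0) : ∀ᵐ ω ∂P, ∀ k, Y k ω ∉ A := by
  have hcampbell := hY.campbell (measurable_one.indicator hA)
  rw [lintegral_indicator_one hA, hμA,
    lintegral_eq_zero_iff (hY.measurable_tsum (measurable_one.indicator hA))] at hcampbell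
  filter_upwards [hcampbell] with ω hω k
  simpa using ENNReal.tsum_eq_zero.1 hω k

lemma ae_pairwise_notMem [SigmaFinite μ] (hY : IsPoissonProcess P μ Y) {B : Set (E × E)}
    (hB : MeasurableSet B) (hμB : ∀ y, μ (Prod.mk y ⁻¹' B) = 0) :
    ∀ᵐ ω ∂P, ∀ n k, k ≠ n → (Y n ω, Y k ω) ∉ B := by
  have := hY.isProbabilityMeasure
  have := Measure.isProbabilityMeasure_map (μ := P) hY.measurable_pointMeasure.aemeasurable
  obtain ⟨T, hT, hvoid, hsec⟩ := hY.exists_measurableSet_void hB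
  have hnull : (μ.prod (P.map fun ω => pointMeasure fun k => Y k ω)) Tᶜ = 0 := by
    rw [Measure.prod_apply hT.compl]
    simp_rw [preimage_compl, prob_compl_eq_one_sub (measurable_prodMk_left hT), hsec, hμB]
    simp
  rw [← hY.slivnyak_mecke, Measure.sum_apply _ hT.compl, ENNReal.tsum_eq_zero] at hnull
  have hmem : ∀ᵐ ω ∂P, ∀ n, (Y n ω, pointMeasureErase n fun k => Y k ω) ∈ T := by
    refine ae_all_iff.2 fun n => ?_
    have hn := hnull n
    rwa [Measure.map_apply ((hY.measurable n).prodMk (hY.measurable_pointMeasureErase n))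
      hT.compl] at hn
  filter_upwards [hvoid, hmem] with ω hω hT n
  exact (hω n).1 (hT n)

lemma ae_finite (hY : IsPoissonProcess P μ Y) {A : Set E} (hA : MeasurableSet A)
    (hμA : μ A ≠ ⊤) : ∀ᵐ ω ∂P, {n | Y n ω ∈ A}.Finite := by
  have hind : Measurable (A.indicator (1 : E → ℝ≥0∞)) := measurable_one.indicator hA
  have hcampbell := hY.campbell hind
  rw [lintegral_indicator_one hA] at hcampbell
  filter_upwards [ae_lt_top (hY.measurable_tsum hind) (hcampbell.trans_ne hμA)] with ω hω
  refine (ENNReal.finite_const_le_of_tsum_ne_top hω.ne one_ne_zero).subset fun n hn => ?_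
  simp [indicator_of_mem (show Y n ω ∈ A from hn)]

end IsPoissonProcess

section Independence

lemma iIndepFun_of_measure_forall_lt {ι Ω α : Type*} [MeasurableSpace Ω] [LinearOrder α]
    [Nonempty α] [TopologicalSpace α] [OrderTopology α] [SecondCountableTopology α]
    [MeasurableSpace α] [BorelSpace α] {P : Measure Ω} [IsProbabilityMeasure P] {f : ι → Ω → α}
    (hf : ∀ i, Measurable (f i))
    (hlt : ∀ (T : Finset ι) (x : ι → α),
      P {ω | ∀ i ∈ T, x i < f i ω} = ∏ i ∈ T, P {ω | x i < f i ω}) :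
    iIndepFun f P := by
  have hpi : IsPiSystem (range (Ioi : α → Set α)) := isPiSystem_Ioi
  refine (iIndepFun_iff_iIndep _ _ _).2 ?_
  refine iIndepSets.iIndep (fun i => (hf i).comap_le)
    (fun i => {A | ∃ C ∈ range (Ioi : α → Set α), f i ⁻¹' C = A})
    (fun i => hpi.comap _) (fun i => ?_) ?_
  · rw [BorelSpace.measurable_eq (α := α), borel_eq_generateFrom_Ioi,
      MeasurableSpace.comap_generateFrom]
    rfl
  · refine (iIndepSets_iff _ _).2 fun T A hA => ?_
    choose! C hC hCA using hA
    choose! x hx using hC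
    have hset : ∀ i ∈ T, A i = {ω | x i < f i ω} := fun i hi => by
      rw [← hCA i hi, ← hx i hi]
      rfl
    have hinter : ⋂ i ∈ T, A i = {ω | ∀ i ∈ T, x i < f i ω} := by
      rw [iInter₂_congr hset]
      ext ω
      simp
    rw [hinter, hlt]
    exact Finset.prod_congr rfl fun i hi => by rw [hset i hi]

variable {Ω : Type*} [MeasurableSpace Ω] {P : Measure Ω}

lemma measure_mem_and_prodMk_mem_of_indepFun {α β : Type*} [MeasurableSpace α] [MeasurableSpace β]
    [IsFiniteMeasure P] {f : Ω → α} {g : Ω → β} (h : IndepFun f g P) (hf : Measurable f)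
    (hg : Measurable g) {D : Set α} (hD : MeasurableSet D) {A : Set (α × β)}
    (hA : MeasurableSet A) :
    P {ω | f ω ∈ D ∧ (f ω, g ω) ∈ A} = ∫⁻ ω in f ⁻¹' D, P {ω' | (f ω, g ω') ∈ A} ∂P := by
  have hDA : MeasurableSet (Prod.fst ⁻¹' D ∩ A) := (measurable_fst hD).inter hA
  have hjoint := lintegral_prodMk_of_indepFun h hf hg (measurable_one.indicator hDA)
  have hleft : ∀ ω, (Prod.fst ⁻¹' D ∩ A).indicator (1 : α × β → ℝ≥0∞) (f ω, g ω) =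
      {ω | f ω ∈ D ∧ (f ω, g ω) ∈ A}.indicator 1 ω := fun ω => rfl
  have hright : ∀ ω ω', (Prod.fst ⁻¹' D ∩ A).indicator (1 : α × β → ℝ≥0∞) (f ω, g ω') =
      (f ⁻¹' D).indicator (fun ω => {ω' | (f ω, g ω') ∈ A}.indicator 1 ω') ω := fun ω ω' => by
    rw [← indicator_indicator]
    rfl
  have hevent : MeasurableSet {ω | f ω ∈ D ∧ (f ω, g ω) ∈ A} := hf.prodMk hg hDA
  simp_rw [hleft, hright, lintegral_indicator_one hevent] at hjoint
  rw [hjoint, ← lintegral_indicator (hf hD)]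
  refine lintegral_congr fun ω => ?_
  by_cases hω : ω ∈ f ⁻¹' D
  · simp only [indicator_of_mem hω]
    exact lintegral_indicator_one (hg (measurable_prodMk_left hA))
  · simp only [indicator_of_notMem hω, lintegral_zero]

variable {α : Type*} [LinearOrder α] [TopologicalSpace α] [OrderTopology α] [MeasurableSpace α]
  [BorelSpace α]

lemma measurable_measure_lt (f : Ω → α) : Measurable fun a => P {ω | a < f ω} :=
  Antitone.measurable fun _ _ hab => measure_mono fun _ h => lt_of_le_of_lt hab h

variable [SecondCountableTopology α] [IsProbabilityMeasure P]

lemma condExp_lt_of_indepFun {f g : Ω → α} (h : IndepFun f g P) (hf : Measurable f)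
    (hg : Measurable g) :
    P⟦{ω | f ω < g ω} | MeasurableSpace.comap f inferInstance⟧ =ᵐ[P]
      fun ω => (P {ω' | f ω < g ω'}).toReal := by
  have hlt : MeasurableSet {ω | f ω < g ω} := measurableSet_lt hf hg
  have htail : Measurable fun a => P {ω | a < g ω} := measurable_measure_lt g
  have hint : Integrable (fun ω => (P {ω' | f ω < g ω'}).toReal) P :=
    Integrable.of_bound (htail.ennreal_toReal.comp hf).aestronglyMeasurable 1
      (Filter.Eventually.of_forall fun ω => by
        rw [Real.norm_of_nonneg ENNReal.toReal_nonneg]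
        exact measureReal_le_one)
  refine (ae_eq_condExp_of_forall_setIntegral_eq hf.comap_le ((integrable_const _).indicator hlt)
    (fun _ _ _ => hint.integrableOn) ?_
    (htail.ennreal_toReal.comp (comap_measurable f)).aestronglyMeasurable).symm
  rintro _ ⟨D, hD, rfl⟩ -
  have hsplit := measure_mem_and_prodMk_mem_of_indepFun h hf hg hD
    (measurableSet_lt measurable_fst measurable_snd)
  simp only [mem_ofPred_eq] at hsplit
  have hcomp : Measurable fun ω => P {ω' | f ω < g ω'} := htail.comp hf
  rw [integral_toReal hcomp.aemeasurable
    (Filter.Eventually.of_forall fun ω => measure_lt_top P _), ← hsplit,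
    setIntegral_indicator hlt, setIntegral_const, smul_eq_mul, mul_one]
  rfl

lemma measure_mem_and_forall_lt_of_iIndepFun {ι : Type*} [DecidableEq ι] [Fintype ι]
    {f : ι → Ω → α} (h : iIndepFun f P) (hf : ∀ i, Measurable (f i)) (i : ι)
    {D : Set α} (hD : MeasurableSet D) :
    P {ω | f i ω ∈ D ∧ ∀ j, j ≠ i → f i ω < f j ω} =
      ∫⁻ ω in f i ⁻¹' D, ∏ j ∈ Finset.univ.erase i, P {ω' | f i ω < f j ω'} ∂P := by
  have hothers : IndepFun (f i) (fun ω (j : Finset.univ.erase i) => f j ω) P :=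
    (h.indepFun_finset {i} (Finset.univ.erase i) (by simp) hf).comp
      (φ := fun g : ({i} : Finset ι) → α => g ⟨i, Finset.mem_singleton_self i⟩)
      (ψ := id) (measurable_pi_apply _) measurable_id
  have hmin : MeasurableSet {q : α × (Finset.univ.erase i → α) | ∀ j, q.1 < q.2 j} := by
    rw [ofPred_forall]
    exact MeasurableSet.iInter fun j => measurableSet_lt measurable_fst
      ((measurable_pi_apply j).comp measurable_snd)
  have hsplit := measure_mem_and_prodMk_mem_of_indepFun hothers (hf i)
    (measurable_pi_lambda _ fun j => hf j) hD hmin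
  simp only [mem_ofPred_eq, Subtype.forall, Finset.mem_erase, Finset.mem_univ, and_true] at hsplit
  rw [hsplit]
  refine lintegral_congr fun ω => ?_
  have hprod := iIndepFun_iff_measure_inter_preimage_eq_mul.1 h (Finset.univ.erase i)
    (sets := fun _ => Ioi (f i ω)) fun _ _ => measurableSet_Ioi
  refine Eq.trans (congrArg P ?_) hprod
  ext ω'
  simp

end Independence

lemma lintegral_fun_norm_plane {f : ℝ → ℝ≥0∞} (hf : Measurable f) :
    ∫⁻ z : Plane, f ‖z‖ =
      ENNReal.ofReal (2 * Real.pi) * ∫⁻ r in Ioi (0 : ℝ), f r * ENNReal.ofReal r := by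
  have hdim : Module.finrank ℝ Plane = 2 := by simp
  have hball : (volume : Measure Plane) (Metric.ball 0 1) = ENNReal.ofReal Real.pi := by
    rw [EuclideanSpace.volume_ball]
    simp [one_add_one_eq_two, Real.sq_sqrt Real.pi_pos.le]
  have hf_Ioi : Measurable fun r : Ioi (0 : ℝ) => f r := hf.comp measurable_subtype_coe
  have hpolar := (volume : Measure Plane).measurePreserving_homeomorphUnitSphereProd
  rw [hdim] at hpolar
  calc ∫⁻ z : Plane, f ‖z‖
      = ∫⁻ z : ({(0)}ᶜ : Set Plane), f ‖z.1‖ ∂((volume : Measure Plane).comap (↑)) := by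
        rw [lintegral_subtype_comap (measurableSet_singleton _).compl fun x : Plane => f ‖x‖,
          restrict_compl_singleton]
    _ = ∫⁻ x, f x.2 ∂(volume : Measure Plane).toSphere.prod (.volumeIoiPow (2 - 1)) := by
        simpa using hpolar.lintegral_comp_emb (Homeomorph.measurableEmbedding _) (fun x => f x.2)
    _ = (volume : Measure Plane).toSphere univ *
          ∫⁻ r : Ioi (0 : ℝ), f r ∂.volumeIoiPow 1 := by
        have hf_snd : Measurable fun x : Metric.sphere (0 : Plane) 1 × Ioi (0 : ℝ) => f x.2 :=
          hf_Ioi.comp measurable_snd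
        rw [lintegral_prod _ hf_snd.aemeasurable]
        simp only [lintegral_const, mul_comm, Nat.add_one_sub_one]
    _ = ENNReal.ofReal (2 * Real.pi) * ∫⁻ r in Ioi (0 : ℝ), f r * ENNReal.ofReal r := by
        rw [Measure.toSphere_apply_univ, hdim, hball, ENNReal.ofReal_mul (by norm_num),
          Measure.volumeIoiPow,
          lintegral_withDensity_eq_lintegral_mul _ (by fun_prop) hf_Ioi,
          ← lintegral_subtype_comap measurableSet_Ioi fun r => f r * ENNReal.ofReal r]
        congr 1
        · norm_num
        · exact lintegral_congr fun r => by simp [mul_comm]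

lemma lintegral_Ioi_eq_lintegral_comp_exp_mul {c : ℝ} (hc : 0 < c) (f : ℝ → ℝ≥0∞) :
    ∫⁻ x in Ioi (0 : ℝ), f x =
      ∫⁻ y : ℝ, ENNReal.ofReal (Real.exp (y * c) * c) * f (Real.exp (y * c)) := by
  have hrange : (fun y : ℝ => Real.exp (y * c)) '' univ = Ioi 0 := by
    rw [image_univ, ← Real.range_exp]
    exact (mul_right_surjective₀ hc.ne').range_comp Real.exp
  have hinj : InjOn (fun y : ℝ => Real.exp (y * c)) univ := fun y _ y' _ h =>
    mul_right_cancel₀ hc.ne' (Real.exp_injective h)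
  have hderiv : ∀ y ∈ (univ : Set ℝ), HasDerivWithinAt (fun y : ℝ => Real.exp (y * c))
      (Real.exp (y * c) * c) univ y := fun y _ => by
    simpa using ((hasDerivAt_id y).mul_const c).exp
  rw [← hrange, lintegral_image_eq_lintegral_abs_deriv_mul MeasurableSet.univ hderiv hinj,
    Measure.restrict_univ]
  exact lintegral_congr fun y => by rw [abs_of_pos (by positivity)]

lemma volume_preimage_const_div_eq_zero (c : ℝ) {U : Set ℝ} (hU : volume U = 0) (hc : c ≠ 0) :
    volume {x : ℝ | c / x ∈ U} = 0 := by
  have himage : volume ((fun u : ℝ => c / u) '' (U \ {0})) = 0 := by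
    refine addHaar_image_eq_zero_of_differentiableOn_of_addHaar_eq_zero volume ?_
      (measure_mono_null sdiff_subset hU)
    intro u hu
    have hu0 : u ≠ 0 := hu.2
    exact (by fun_prop (disch := assumption) :
      DifferentiableAt ℝ (fun u : ℝ => c / u) u).differentiableWithinAt
  refine measure_mono_null (fun x hx => ?_)
    (measure_union_null himage (Real.volume_singleton (a := 0)))
  by_cases hx0 : x = 0
  · exact Or.inr hx0
  · exact Or.inl ⟨c / x, ⟨hx, div_ne_zero hc hx0⟩, div_div_cancel₀ hc⟩

namespace NetworkParams

variable {S : Type*} [Fintype S] (N : NetworkParams S)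

@[fun_prop]
lemma measurable_p (s : S) : Measurable (N.p s) := by
  unfold p
  refine Finset.measurable_sum _ fun b _ => Measurable.const_mul (measurable_const.indicator ?_) _
  exact (measurableSet_le measurable_const ENNReal.measurable_ofReal).inter
    (measurableSet_lt ENNReal.measurable_ofReal measurable_const)

lemma p_nonneg (s : S) (r : ℝ) : 0 ≤ N.p s r :=
  Finset.sum_nonneg fun b _ => mul_nonneg (N.q_nonneg b s)
    (indicator_nonneg (fun _ _ => zero_le_one) _)

lemma p_le (s : S) (r : ℝ) : N.p s r ≤ ∑ b, N.q b s :=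
  Finset.sum_le_sum fun b _ => mul_le_of_le_one_right (N.q_nonneg b s)
    (indicator_le_self' (fun _ _ => zero_le_one) _)

lemma pathLoss_nonneg (s : S) {r : ℝ} (hr : 0 ≤ r) : 0 ≤ N.pathLoss s r :=
  mul_nonneg (N.kappa_pos s).le (Real.rpow_nonneg hr _)

lemma pathLoss_pos (s : S) {r : ℝ} (hr : 0 < r) : 0 < N.pathLoss s r :=
  mul_pos (N.kappa_pos s) (Real.rpow_pos_of_pos hr _)

@[fun_prop]
lemma measurable_pathLoss (s : S) : Measurable (N.pathLoss s) := by
  unfold pathLoss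
  fun_prop

lemma exp_mul_shadowPDF_exp (s : S) (y : ℝ) :
    Real.exp (y * (Real.log 10 / 10)) * (Real.log 10 / 10) *
        N.shadowPDF s (Real.exp (y * (Real.log 10 / 10))) =
      gaussianPDFReal (N.mu s) (N.sigma s ^ 2).toNNReal y := by
  have hσ := N.sigma_pos s
  have hdB : 10 * Real.logb 10 (Real.exp (y * (Real.log 10 / 10))) = y := by
    rw [Real.logb, Real.log_exp]
    field_simp
  rw [shadowPDF, if_pos (Real.exp_pos _), gaussianPDFReal, Real.coe_toNNReal _ (by positivity),
    hdB, Real.sqrt_mul (by positivity : 0 ≤ 2 * Real.pi) (N.sigma s ^ 2), Real.sqrt_sq hσ.le]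
  have := (Real.exp_pos (y * (Real.log 10 / 10))).ne'
  field_simp

lemma shadowLaw_eq_map_gaussianReal (s : S) :
    N.shadowLaw s = (gaussianReal (N.mu s) (N.sigma s ^ 2).toNNReal).map
      (fun y => Real.exp (y * (Real.log 10 / 10))) := by
  have hvar : (N.sigma s ^ 2).toNNReal ≠ 0 := by
    simpa using pow_ne_zero 2 (N.sigma_pos s).ne'
  have hdB : 0 < Real.log 10 / 10 := div_pos (Real.log_pos (by norm_num)) (by norm_num)
  have hexp : Measurable fun y : ℝ => Real.exp (y * (Real.log 10 / 10)) := by fun_prop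
  refine Measure.ext fun A hA => ?_
  have hsupport : A.indicator (fun x => ENNReal.ofReal (N.shadowPDF s x)) =
      (Ioi (0 : ℝ)).indicator (A.indicator fun x => ENNReal.ofReal (N.shadowPDF s x)) := by
    refine (indicator_eq_self.2 fun x hx => ?_).symm
    by_contra hx0
    by_cases hxA : x ∈ A <;> simp [hxA, shadowPDF, show ¬ 0 < x from hx0] at hx
  rw [shadowLaw, withDensity_apply _ hA, ← lintegral_indicator hA, hsupport,
    lintegral_indicator measurableSet_Ioi, lintegral_Ioi_eq_lintegral_comp_exp_mul hdB,
    Measure.map_apply hexp hA, gaussianReal_of_var_ne_zero _ hvar, withDensity_apply _ (hexp hA),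
    ← lintegral_indicator (hexp hA)]
  refine lintegral_congr fun y => ?_
  by_cases hy : y ∈ (fun y : ℝ => Real.exp (y * (Real.log 10 / 10))) ⁻¹' A
  · rw [indicator_of_mem hy, indicator_of_mem (mem_preimage.1 hy),
      ← ENNReal.ofReal_mul (by positivity), N.exp_mul_shadowPDF_exp, gaussianPDF]
  · rw [indicator_of_notMem hy, indicator_of_notMem (mt mem_preimage.2 hy), mul_zero]

instance (s : S) : IsProbabilityMeasure (N.shadowLaw s) := by
  rw [shadowLaw_eq_map_gaussianReal]
  exact Measure.isProbabilityMeasure_map (by fun_prop)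

lemma ae_shadowLaw_pos (s : S) : ∀ᵐ x ∂(N.shadowLaw s), 0 < x := by
  rw [shadowLaw_eq_map_gaussianReal, ae_map_iff (by fun_prop) measurableSet_Ioi]
  exact ae_of_all _ fun y => Real.exp_pos _

lemma shadowLaw_absolutelyContinuous (s : S) : N.shadowLaw s ≪ volume :=
  withDensity_absolutelyContinuous _ _

lemma lintegral_rpow_shadowLaw_lt_top (s : S) (a : ℝ) :
    ∫⁻ x, ENNReal.ofReal (x ^ a) ∂(N.shadowLaw s) < ⊤ := by
  rw [shadowLaw_eq_map_gaussianReal, lintegral_map (by fun_prop) (by fun_prop)]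
  refine lt_of_eq_of_lt (lintegral_congr fun y => ?_)
    (integrable_exp_mul_gaussianReal (μ := N.mu s) (v := (N.sigma s ^ 2).toNNReal)
      (Real.log 10 / 10 * a)).lintegral_lt_top
  rw [← Real.exp_mul]
  congr 2
  ring

/-- The measure `p s r * r dr` on `(0, ∞)`: up to the factor `2 * π`, the intensity of the lengths
of the links in state `s` when the base stations have unit density. -/
def radialMeasure (s : S) : Measure ℝ :=
  (volume.restrict (Ioi 0)).withDensity fun r => ENNReal.ofReal (N.p s r * r)

instance (s : S) : SFinite (N.radialMeasure s) := by
  unfold radialMeasure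
  infer_instance

lemma lintegral_radialMeasure (s : S) {f : ℝ → ℝ≥0∞} (hf : Measurable f) :
    ∫⁻ r, f r ∂(N.radialMeasure s) = ∫⁻ r in Ioi (0 : ℝ), f r * ENNReal.ofReal (N.p s r * r) := by
  rw [radialMeasure, lintegral_withDensity_eq_lintegral_mul _ (by fun_prop) hf]
  exact lintegral_congr fun r => mul_comm _ _

lemma ae_radialMeasure_pos (s : S) : ∀ᵐ r ∂(N.radialMeasure s), 0 < r :=
  (withDensity_absolutelyContinuous _ _).ae_le (ae_restrict_mem measurableSet_Ioi)

lemma lintegral_p_norm_mul (s : S) {f : ℝ → ℝ≥0∞} (hf : Measurable f) :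
    ∫⁻ z : Plane, ENNReal.ofReal (N.p s ‖z‖) * f ‖z‖ =
      ENNReal.ofReal (2 * Real.pi) * ∫⁻ r, f r ∂(N.radialMeasure s) := by
  rw [lintegral_fun_norm_plane (f := fun r => ENNReal.ofReal (N.p s r) * f r) (by fun_prop),
    N.lintegral_radialMeasure s hf]
  congr 1
  refine lintegral_congr fun r => ?_
  rw [ENNReal.ofReal_mul (N.p_nonneg s r)]
  ring

lemma radialMeasure_Iic (s : S) (R : ℝ) :
    N.radialMeasure s (Iic R) = ∫⁻ r in Ioc 0 R, ENNReal.ofReal (N.p s r * r) := by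
  rw [radialMeasure, withDensity_apply _ measurableSet_Iic,
    Measure.restrict_restrict measurableSet_Iic, inter_comm, Ioi_inter_Iic]

lemma radialMeasure_Iic_le (s : S) {R : ℝ} (hR : 0 ≤ R) :
    N.radialMeasure s (Iic R) ≤ ENNReal.ofReal ((∑ b, N.q b s) * R ^ 2) := by
  have hq : 0 ≤ ∑ b, N.q b s := Finset.sum_nonneg fun b _ => N.q_nonneg b s
  calc N.radialMeasure s (Iic R)
      = ∫⁻ r in Ioc 0 R, ENNReal.ofReal (N.p s r * r) := N.radialMeasure_Iic s R
    _ ≤ ∫⁻ _ in Ioc (0 : ℝ) R, ENNReal.ofReal ((∑ b, N.q b s) * R) :=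
        setLIntegral_mono measurable_const fun _ hr => ENNReal.ofReal_le_ofReal
          (mul_le_mul (N.p_le s _) hr.2 hr.1.le hq)
    _ = ENNReal.ofReal ((∑ b, N.q b s) * R ^ 2) := by
        rw [setLIntegral_const, Real.volume_Ioc, sub_zero, ← ENNReal.ofReal_mul (by positivity)]
        congr 1
        ring

lemma intervalIntegral_p_mul (s : S) {R : ℝ} (hR : 0 ≤ R) :
    ∫ r in (0 : ℝ)..R, N.p s r * r = (N.radialMeasure s (Iic R)).toReal := by
  rw [intervalIntegral.integral_of_le hR, integral_eq_lintegral_of_nonneg_ae, radialMeasure_Iic]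
  · filter_upwards [ae_restrict_mem measurableSet_Ioc] with r hr
    exact mul_nonneg (N.p_nonneg s r) hr.1.le
  · exact ((N.measurable_p s).mul measurable_id).aestronglyMeasurable

/-- The radius at which a link in state `s` with shadowing `x` has inverse average received
power `ξ`. -/
def reach (s : S) (ξ x : ℝ) : ℝ := (x * ξ / N.kappa s) ^ (1 / N.alpha s)

lemma pathLoss_div_le_iff (s : S) {r x ξ : ℝ} (hr : 0 ≤ r) (hx : 0 < x) (hξ : 0 ≤ ξ) :
    N.pathLoss s r / x ≤ ξ ↔ r ≤ N.reach s ξ x := by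
  have hκ := N.kappa_pos s
  rw [pathLoss, reach, one_div, Real.le_rpow_inv_iff_of_pos hr (by positivity) (N.alpha_pos s),
    le_div_iff₀ hκ, div_le_iff₀ hx, mul_comm ξ, mul_comm (N.kappa s)]

lemma measurable_radialMeasure_Iic_reach (s : S) (ξ : ℝ) :
    Measurable fun x => N.radialMeasure s (Iic (N.reach s ξ x)) := by
  have hmono : Monotone fun R => N.radialMeasure s (Iic R) := fun _ _ h =>
    measure_mono (Iic_subset_Iic.2 h)
  have hreach : Measurable (N.reach s ξ) := by
    unfold reach
    fun_prop
  exact hmono.measurable.comp hreach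

lemma lintegral_radialMeasure_Iic_reach_lt_top (s : S) {ξ : ℝ} (hξ : 0 ≤ ξ) :
    ∫⁻ x, N.radialMeasure s (Iic (N.reach s ξ x)) ∂(N.shadowLaw s) < ⊤ := by
  have hκ := N.kappa_pos s
  set C := (∑ b, N.q b s) * ((ξ / N.kappa s) ^ (1 / N.alpha s)) ^ 2
  have hC : 0 ≤ C := mul_nonneg (Finset.sum_nonneg fun b _ => N.q_nonneg b s) (sq_nonneg _)
  calc ∫⁻ x, N.radialMeasure s (Iic (N.reach s ξ x)) ∂(N.shadowLaw s)
      ≤ ∫⁻ x, ENNReal.ofReal C * ENNReal.ofReal (x ^ (1 / N.alpha s * 2)) ∂(N.shadowLaw s) := by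
        refine lintegral_mono_ae ?_
        filter_upwards [N.ae_shadowLaw_pos s] with x hx
        refine (N.radialMeasure_Iic_le s (by unfold reach; positivity)).trans (le_of_eq ?_)
        rw [← ENNReal.ofReal_mul hC, reach, mul_div_assoc, Real.mul_rpow hx.le (by positivity),
          Real.rpow_mul hx.le]
        congr 1
        norm_num [C]
        ring
    _ < ⊤ := by
        rw [lintegral_const_mul' _ _ ENNReal.ofReal_ne_top]
        exact ENNReal.mul_lt_top ENNReal.ofReal_lt_top (N.lintegral_rpow_shadowLaw_lt_top s _)

lemma Lambda_eq_toReal (s : S) {ξ : ℝ} (hξ : 0 ≤ ξ) :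
    N.Lambda s ξ = 2 * Real.pi * N.lam *
      (∫⁻ x, N.radialMeasure s (Iic (N.reach s ξ x)) ∂(N.shadowLaw s)).toReal := by
  have hκ := N.kappa_pos s
  have hmeas := N.measurable_radialMeasure_Iic_reach s ξ
  rw [Lambda, ← integral_toReal hmeas.aemeasurable
    (ae_lt_top hmeas (N.lintegral_radialMeasure_Iic_reach_lt_top s hξ).ne)]
  congr 1
  refine integral_congr_ae ?_
  filter_upwards [N.ae_shadowLaw_pos s] with x hx
  exact N.intervalIntegral_p_mul s (by positivity)

lemma Lambda_nonneg (s : S) {ξ : ℝ} (hξ : 0 ≤ ξ) : 0 ≤ N.Lambda s ξ := by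
  have := N.lam_pos
  rw [N.Lambda_eq_toReal s hξ]
  positivity

lemma ofReal_Lambda (s : S) {ξ : ℝ} (hξ : 0 ≤ ξ) :
    ENNReal.ofReal (N.Lambda s ξ) = ENNReal.ofReal (2 * Real.pi * N.lam) *
      ∫⁻ x, N.radialMeasure s (Iic (N.reach s ξ x)) ∂(N.shadowLaw s) := by
  have := N.lam_pos
  rw [N.Lambda_eq_toReal s hξ, ENNReal.ofReal_mul (by positivity),
    ENNReal.ofReal_toReal (N.lintegral_radialMeasure_Iic_reach_lt_top s hξ).ne]

lemma integral_cRadius_eq_Lambda (s t : S) (r x : ℝ) :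
    2 * Real.pi * N.lam * ∫ x', (∫ ρ in (0 : ℝ)..N.cRadius s t r x' x, N.p t ρ * ρ)
      ∂(N.shadowLaw t) = N.Lambda t (N.pathLoss s r / x) := by
  have hradius : ∀ x', N.cRadius s t r x' x =
      (x' * (N.pathLoss s r / x) / N.kappa t) ^ (1 / N.alpha t) := fun x' => by
    rw [cRadius, pathLoss]
    congr 1
    ring
  simp_rw [hradius, Lambda]

/-- Intensity measure of the inverse average received powers of the links in state `s`; the paper's
`Λ_s`. -/
def linkIntensity (s : S) : Measure ℝ :=
  ENNReal.ofReal (2 * Real.pi * N.lam) •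
    ((N.radialMeasure s).prod (N.shadowLaw s)).map fun q => N.pathLoss s q.1 / q.2

@[fun_prop]
lemma measurable_pathLoss_div (s : S) : Measurable fun q : ℝ × ℝ => N.pathLoss s q.1 / q.2 := by
  fun_prop

lemma lintegral_linkIntensity (s : S) {f : ℝ → ℝ≥0∞} (hf : Measurable f) :
    ∫⁻ ξ, f ξ ∂(N.linkIntensity s) = ENNReal.ofReal (2 * Real.pi * N.lam) *
      ∫⁻ r, ∫⁻ x, f (N.pathLoss s r / x) ∂(N.shadowLaw s) ∂(N.radialMeasure s) := by
  have hcomp : Measurable fun q : ℝ × ℝ => f (N.pathLoss s q.1 / q.2) := by fun_prop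
  rw [linkIntensity, lintegral_smul_measure, lintegral_map hf (by fun_prop), smul_eq_mul,
    lintegral_prod _ hcomp.aemeasurable]

lemma linkIntensity_absolutelyContinuous (s : S) : N.linkIntensity s ≪ volume := by
  refine Measure.AbsolutelyContinuous.mk fun U hU hU0 => ?_
  rw [linkIntensity, Measure.smul_apply, Measure.map_apply (N.measurable_pathLoss_div s) hU,
    (Measure.measure_prod_null (N.measurable_pathLoss_div s hU)).2, smul_zero]
  filter_upwards [N.ae_radialMeasure_pos s] with r hr
  exact N.shadowLaw_absolutelyContinuous s
    (volume_preimage_const_div_eq_zero _ hU0 (N.pathLoss_pos s hr).ne')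

lemma linkIntensity_Iic (s : S) {ξ : ℝ} (hξ : 0 ≤ ξ) :
    N.linkIntensity s (Iic ξ) = ENNReal.ofReal (N.Lambda s ξ) := by
  rw [linkIntensity, Measure.smul_apply,
    Measure.map_apply (N.measurable_pathLoss_div s) measurableSet_Iic,
    Measure.prod_apply_symm (N.measurable_pathLoss_div s measurableSet_Iic),
    N.ofReal_Lambda s hξ, smul_eq_mul]
  congr 1
  refine lintegral_congr_ae ?_
  filter_upwards [N.ae_shadowLaw_pos s] with x hx
  refine measure_congr ?_
  filter_upwards [N.ae_radialMeasure_pos s] with r hr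
  exact propext (N.pathLoss_div_le_iff s hr.le hx hξ)

lemma linkIntensity_Iio (s : S) {ξ : ℝ} (hξ : 0 ≤ ξ) :
    N.linkIntensity s (Iio ξ) = ENNReal.ofReal (N.Lambda s ξ) := by
  rw [← N.linkIntensity_Iic s hξ]
  exact measure_congr ((N.linkIntensity_absolutelyContinuous s).ae_le Iio_ae_eq_Iic)

end NetworkParams

namespace NetworkParams

variable {S : Type*} [Fintype S] (N : NetworkParams S) {M : Type*} [MeasurableSpace M]

/-- Intensity measure of the base stations together with their marks. -/
def bsIntensity (ν : Measure M) : Measure (Plane × M) :=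
  (ENNReal.ofReal N.lam • volume).prod ν

variable (ν : Measure M) [IsProbabilityMeasure ν]

instance : SigmaFinite (N.bsIntensity ν) := by
  have : SigmaFinite (ENNReal.ofReal N.lam • (volume : Measure Plane)) :=
    inferInstanceAs (SigmaFinite (N.lam.toNNReal • (volume : Measure Plane)))
  unfold bsIntensity
  infer_instance

lemma lintegral_bsIntensity {f : Plane × M → ℝ≥0∞} (hf : Measurable f) :
    ∫⁻ b, f b ∂(N.bsIntensity ν) = ENNReal.ofReal N.lam * ∫⁻ x, ∫⁻ m, f (x, m) ∂ν := by
  rw [bsIntensity, lintegral_prod _ hf.aemeasurable, lintegral_smul_measure, smul_eq_mul]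

lemma bsIntensity_apply {A : Set (Plane × M)} (hA : MeasurableSet A) :
    N.bsIntensity ν A = ENNReal.ofReal N.lam * ∫⁻ x, ν (Prod.mk x ⁻¹' A) := by
  rw [bsIntensity, Measure.prod_apply hA, lintegral_smul_measure, smul_eq_mul]

lemma bsIntensity_translate (x : Plane) {A : Set (Plane × M)} (hA : MeasurableSet A) :
    N.bsIntensity ν {b | (b.1 - x, b.2) ∈ A} = N.bsIntensity ν A := by
  have htranslate : Measurable fun b : Plane × M => (b.1 - x, b.2) := by fun_prop
  change N.bsIntensity ν ((fun b => (b.1 - x, b.2)) ⁻¹' A) = _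
  rw [N.bsIntensity_apply ν hA, N.bsIntensity_apply ν (htranslate hA)]
  congr 1
  exact lintegral_sub_right_eq_self (fun y => ν (Prod.mk y ⁻¹' A)) x

end NetworkParams

namespace LinkField

variable {S : Type*} [Fintype S] [MeasurableSpace S] {N : NetworkParams S}
  {M : Type*} [MeasurableSpace M] {ν : Measure M} (F : LinkField N ν)

lemma measurable_linkState :
    Measurable fun q : Plane × (Plane × M) => F.linkState q.1 q.2 :=
  F.measurable_state.comp ((measurable_fst.sub (measurable_fst.comp measurable_snd)).prodMk
    (measurable_snd.comp measurable_snd))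

lemma measurable_linkState_right (z : Plane) : Measurable (F.linkState z) :=
  F.measurable_linkState.comp measurable_prodMk_left

lemma measurable_linkShadow :
    Measurable fun q : Plane × (Plane × M) => F.shadow (q.1 - q.2.1) q.2.2 :=
  F.measurable_shadow.comp ((measurable_fst.sub (measurable_fst.comp measurable_snd)).prodMk
    (measurable_snd.comp measurable_snd))

lemma measurable_norm_linkShadow (z : Plane) :
    Measurable fun b : Plane × M => (‖z - b.1‖, F.shadow (z - b.1) b.2) :=
  (by fun_prop : Measurable fun b : Plane × M => ‖z - b.1‖).prodMk
    (F.measurable_linkShadow.comp measurable_prodMk_left)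

lemma measurable_shadow_right (y : Plane) : Measurable (F.shadow y) :=
  F.measurable_shadow.comp measurable_prodMk_left

lemma map_shadow_restrict_state (y : Plane) (s : S) :
    (ν.restrict {m | F.state y m = s}).map (F.shadow y) =
      ENNReal.ofReal (N.p s ‖y‖) • N.shadowLaw s := by
  have hshadow := F.measurable_shadow_right y
  refine Measure.ext fun A hA => ?_
  rw [Measure.map_apply hshadow hA, Measure.restrict_apply (hshadow hA), Measure.smul_apply,
    smul_eq_mul, ← F.law y s A hA, inter_comm]
  rfl

lemma setLIntegral_state_eq (y : Plane) (s : S) {g : ℝ → ℝ≥0∞} (hg : Measurable g) :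
    ∫⁻ m in {m | F.state y m = s}, g (F.shadow y m) ∂ν =
      ENNReal.ofReal (N.p s ‖y‖) * ∫⁻ x, g x ∂(N.shadowLaw s) := by
  rw [← lintegral_map hg (F.measurable_shadow_right y), F.map_shadow_restrict_state y s,
    lintegral_smul_measure, smul_eq_mul]

lemma measure_state_eq (y : Plane) (s : S) :
    ν {m | F.state y m = s} = ENNReal.ofReal (N.p s ‖y‖) := by
  simpa using F.law y s univ MeasurableSet.univ

variable [MeasurableSingletonClass S]

lemma measurableSet_state_eq (y : Plane) (s : S) : MeasurableSet {m | F.state y m = s} :=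
  (F.measurable_state.comp measurable_prodMk_left) (measurableSet_singleton s)

lemma measurableSet_linkState_eq (z : Plane) (s : S) : MeasurableSet {b | F.linkState z b = s} :=
  F.measurable_linkState_right z (measurableSet_singleton s)

lemma measurable_invPower :
    Measurable fun q : Plane × (Plane × M) => F.invPower q.1 q.2 := by
  have hkappa : Measurable N.kappa := Measurable.of_discrete
  have halpha : Measurable N.alpha := Measurable.of_discrete
  have hlength : Measurable fun q : Plane × (Plane × M) => ‖q.1 - q.2.1‖ := by fun_prop
  exact ((hkappa.comp F.measurable_linkState).mul
    (hlength.pow (halpha.comp F.measurable_linkState))).div F.measurable_linkShadow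

lemma measurable_invPower_right (z : Plane) : Measurable (F.invPower z) :=
  F.measurable_invPower.comp measurable_prodMk_left

lemma measurableSet_linkState_eq_and_invPower_mem (z : Plane) (s : S) {U : Set ℝ}
    (hU : MeasurableSet U) : MeasurableSet {b | F.linkState z b = s ∧ F.invPower z b ∈ U} :=
  (F.measurableSet_linkState_eq z s).inter (F.measurable_invPower_right z hU)

variable [IsProbabilityMeasure ν]

lemma map_norm_linkShadow_restrict_linkState (z : Plane) (s : S) :
    ((N.bsIntensity ν).restrict {b | F.linkState z b = s}).map
        (fun b => (‖z - b.1‖, F.shadow (z - b.1) b.2)) =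
      ENNReal.ofReal (2 * Real.pi * N.lam) • (N.radialMeasure s).prod (N.shadowLaw s) := by
  refine Measure.ext_of_lintegral _ fun f hf => ?_
  have hlink : Measurable fun b : Plane × M => f (‖z - b.1‖, F.shadow (z - b.1) b.2) :=
    hf.comp (F.measurable_norm_linkShadow z)
  have hstate := F.measurableSet_linkState_eq z s
  rw [lintegral_map hf (F.measurable_norm_linkShadow z), ← lintegral_indicator hstate,
    N.lintegral_bsIntensity ν (hlink.indicator hstate), lintegral_smul_measure, smul_eq_mul,
    lintegral_prod _ hf.aemeasurable]
  have hmark : ∀ x : Plane, ∫⁻ m, {b | F.linkState z b = s}.indicator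
      (fun b => f (‖z - b.1‖, F.shadow (z - b.1) b.2)) (x, m) ∂ν =
      ENNReal.ofReal (N.p s ‖z - x‖) * ∫⁻ x', f (‖z - x‖, x') ∂(N.shadowLaw s) := fun x => by
    have hfiber : Measurable fun x' => f (‖z - x‖, x') := hf.comp measurable_prodMk_left
    rw [← F.setLIntegral_state_eq (z - x) s hfiber,
      ← lintegral_indicator (F.measurableSet_state_eq (z - x) s)]
    rfl
  simp only [hmark]
  rw [lintegral_sub_left_eq_self (fun y : Plane => ENNReal.ofReal (N.p s ‖y‖) *
      ∫⁻ x', f (‖y‖, x') ∂(N.shadowLaw s)) z,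
    N.lintegral_p_norm_mul s (hf.lintegral_prod_right' (ν := N.shadowLaw s)), ← mul_assoc,
    ← ENNReal.ofReal_mul N.lam_pos.le, mul_comm N.lam]

lemma map_invPower_restrict_linkState (z : Plane) (s : S) :
    ((N.bsIntensity ν).restrict {b | F.linkState z b = s}).map (F.invPower z) =
      N.linkIntensity s := by
  rw [NetworkParams.linkIntensity, ← Measure.map_smul,
    ← F.map_norm_linkShadow_restrict_linkState z s,
    Measure.map_map (N.measurable_pathLoss_div s) (F.measurable_norm_linkShadow z)]
  refine Measure.map_congr ?_
  filter_upwards [ae_restrict_mem (F.measurableSet_linkState_eq z s)] with b hb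
  rw [invPower, show F.linkState z b = s from hb, Function.comp_apply]

lemma setLIntegral_linkState_eq (z : Plane) (s : S) {g : ℝ → ℝ≥0∞} (hg : Measurable g) :
    ∫⁻ b in {b | F.linkState z b = s}, g (F.invPower z b) ∂(N.bsIntensity ν) =
      ∫⁻ ξ, g ξ ∂(N.linkIntensity s) := by
  rw [← F.map_invPower_restrict_linkState z s, lintegral_map hg (F.measurable_invPower_right z)]

lemma bsIntensity_linkState_eq_and_invPower_mem (z : Plane) (s : S) {U : Set ℝ}
    (hU : MeasurableSet U) :
    N.bsIntensity ν {b | F.linkState z b = s ∧ F.invPower z b ∈ U} = N.linkIntensity s U := by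
  rw [← F.map_invPower_restrict_linkState z s,
    Measure.map_apply (F.measurable_invPower_right z) hU,
    Measure.restrict_apply (F.measurable_invPower_right z hU), inter_comm]
  rfl

lemma bsIntensity_invPower_mem (z : Plane) {U : Set ℝ} (hU : MeasurableSet U) :
    N.bsIntensity ν {b | F.invPower z b ∈ U} = ∑ s, N.linkIntensity s U := by
  simp_rw [← fun s => F.bsIntensity_linkState_eq_and_invPower_mem z s hU]
  rw [← measure_biUnion_finset]
  · congr 1
    ext b
    simp
  · exact fun s _ t _ hst => Set.disjoint_left.2 fun b hs ht => hst (hs.1.symm.trans ht.1)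
  · exact fun s _ => F.measurableSet_linkState_eq_and_invPower_mem z s hU

end LinkField

section Palm

variable {M : Type*} [MeasurableSpace M]

lemma measurable_typicalPoint : Measurable fun a : ℕ × Config M => a.2 a.1 :=
  measurable_from_prod_countable_right fun n => measurable_pi_apply n

lemma measurableSet_mark_mem_and_void {C : Set M} (hC : MeasurableSet C)
    {D : Set (M × (Plane × M))} (hD : MeasurableSet D) :
    MeasurableSet
      {a : ℕ × Config M | (a.2 a.1).2 ∈ C ∧ ∀ k, k ≠ a.1 → ((a.2 a.1).2, a.2 k) ∉ D} := by
  refine MeasurableSet.inter (measurable_typicalPoint.snd hC) ?_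
  change MeasurableSet {a : ℕ × Config M | ∀ k, k ≠ a.1 → ((a.2 a.1).2, a.2 k) ∉ D}
  simp_rw [ofPred_forall]
  refine MeasurableSet.iInter fun k => ?_
  have hself : MeasurableSet {a : ℕ × Config M | a.1 = k} :=
    measurable_fst (measurableSet_singleton k)
  have hvoid : MeasurableSet {a : ℕ × Config M | ((a.2 a.1).2, a.2 k) ∉ D} :=
    ((measurable_typicalPoint.snd.prodMk ((measurable_pi_apply k).comp measurable_snd)) hD).compl
  convert hself.union hvoid using 1
  ext a
  simp only [mem_ofPred_eq, mem_union, eq_comm (a := a.1)]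
  tauto

variable {Ω : Type*} [MeasurableSpace Ω] {P : Measure Ω} {X : ℕ → Ω → Plane} {K : ℕ → Ω → M}
  {W : Set Plane}

lemma palm_apply (hX : ∀ n, Measurable (X n)) (hK : ∀ n, Measurable (K n)) (lam : ℝ)
    {A : Set (ℕ × Config M)} (hA : MeasurableSet A) :
    palm P lam X K W A = (ENNReal.ofReal lam * volume W)⁻¹ *
      ∑' n, P {ω | (n, fun k => (X k ω - X n ω, K k ω)) ∈ A ∧ X n ω ∈ W} := by
  rw [palm, Measure.smul_apply, Measure.sum_apply _ hA, smul_eq_mul]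
  congr 1
  refine tsum_congr fun n => ?_
  have hview : Measurable fun ω => ((n, fun k => (X k ω - X n ω, K k ω)) : ℕ × Config M) :=
    measurable_const.prodMk (measurable_pi_lambda _ fun k => ((hX k).sub (hX n)).prodMk (hK k))
  rw [Measure.map_apply hview hA, Measure.restrict_apply (hview hA)]
  rfl

lemma palm_ae_typicalPoint (hX : ∀ n, Measurable (X n)) (hK : ∀ n, Measurable (K n)) (lam : ℝ) :
    ∀ᵐ a ∂(palm P lam X K W), (a.2 a.1).1 = 0 := by
  have hzero : MeasurableSet {a : ℕ × Config M | (a.2 a.1).1 = 0} :=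
    measurable_typicalPoint.fst (measurableSet_singleton 0)
  rw [ae_iff]
  refine (palm_apply hX hK lam hzero.compl).trans ?_
  simp

variable {S : Type*} [Fintype S] {N : NetworkParams S} {ν : Measure M} [IsProbabilityMeasure ν]

lemma lintegral_bsIntensity_window (hW : MeasurableSet W) {C : Set M} (hC : MeasurableSet C)
    {f : M → ℝ≥0∞} (hf : Measurable f) :
    ∫⁻ b in W ×ˢ C, f b.2 ∂(N.bsIntensity ν) =
      ENNReal.ofReal N.lam * volume W * ∫⁻ m in C, f m ∂ν := by
  have hmark : Measurable fun b : Plane × M => f b.2 := hf.comp measurable_snd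
  rw [← lintegral_indicator (hW.prod hC),
    N.lintegral_bsIntensity ν (hmark.indicator (hW.prod hC)), mul_assoc, mul_comm (volume W),
    ← lintegral_indicator_const hW]
  congr 1
  refine lintegral_congr fun x => ?_
  by_cases hx : x ∈ W
  · rw [indicator_of_mem hx, ← lintegral_indicator hC]
    refine lintegral_congr fun m => ?_
    by_cases hm : m ∈ C <;> simp [hx, hm]
  · simp [hx]

-- The Slivnyak-Mecke void formula over the window, together with the translation invariance of the
-- intensity: the other base stations seen from the typical one are again Poisson.
lemma palm_mark_mem_and_void
    (hY : IsPoissonProcess P (N.bsIntensity ν) fun n ω => (X n ω, K n ω))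
    (hW : MeasurableSet W) (hWzero : volume W ≠ 0) (hWtop : volume W ≠ ⊤)
    {C : Set M} (hC : MeasurableSet C) {D : Set (M × (Plane × M))} (hD : MeasurableSet D) :
    palm P N.lam X K W {a | (a.2 a.1).2 ∈ C ∧ ∀ k, k ≠ a.1 → ((a.2 a.1).2, a.2 k) ∉ D} =
      ∫⁻ m in C, expNeg (N.bsIntensity ν {b | (m, b) ∈ D}) ∂ν := by
  have hrelative :
      Measurable fun q : (Plane × M) × (Plane × M) => (q.1.2, (q.2.1 - q.1.1, q.2.2)) := by
    fun_prop
  have htranslate : ∀ y : Plane × M, N.bsIntensity ν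
      (Prod.mk y ⁻¹' ((fun q => (q.1.2, (q.2.1 - q.1.1, q.2.2))) ⁻¹' D)) =
        N.bsIntensity ν {b | (y.2, b) ∈ D} := fun y =>
    N.bsIntensity_translate ν y.1 (A := {b | (y.2, b) ∈ D}) (measurable_prodMk_left hD)
  have hvoid : Measurable fun m => expNeg (N.bsIntensity ν {b | (m, b) ∈ D}) :=
    measurable_expNeg.comp (measurable_measure_prodMk_left hD)
  have hmecke := hY.tsum_measure_mem_and_void (hW.prod hC) (hrelative hD)
  simp_rw [htranslate] at hmecke
  rw [lintegral_bsIntensity_window hW hC hvoid] at hmecke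
  rw [palm_apply (fun n => (hY.measurable n).fst) (fun n => (hY.measurable n).snd) _
    (measurableSet_mark_mem_and_void hC hD)]
  have hwindow : ENNReal.ofReal N.lam * volume W ≠ 0 :=
    mul_ne_zero (by simpa using N.lam_pos) hWzero
  rw [← one_mul (lintegral _ _), ← ENNReal.inv_mul_cancel hwindow
    (ENNReal.mul_ne_top ENNReal.ofReal_ne_top hWtop), mul_assoc]
  refine congrArg _ (Eq.trans (tsum_congr fun n => congrArg P ?_) hmecke)
  ext ω
  simp only [mem_ofPred_eq, mem_prod, mem_preimage]
  tauto

lemma isProbabilityMeasure_palm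
    (hY : IsPoissonProcess P (N.bsIntensity ν) fun n ω => (X n ω, K n ω))
    (hW : MeasurableSet W) (hWzero : volume W ≠ 0) (hWtop : volume W ≠ ⊤) :
    IsProbabilityMeasure (palm P N.lam X K W) :=
  ⟨by simpa using
    palm_mark_mem_and_void hY hW hWzero hWtop MeasurableSet.univ MeasurableSet.empty⟩

end Palm

namespace NetworkParams

variable {S : Type*} [Fintype S] (N : NetworkParams S)

/-- Probability that, under the Palm distribution, a location at distance `r` from the typical base
station is served by it, given that the link between them is in state `s`. -/
def coverage (s : S) (r : ℝ) : ℝ≥0∞ :=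
  ∫⁻ x, expNeg (∑ t, N.linkIntensity t (Iio (N.pathLoss s r / x))) ∂(N.shadowLaw s)

lemma measurable_expNeg_linkIntensity_Iio :
    Measurable fun ξ => expNeg (∑ t, N.linkIntensity t (Iio ξ)) := by
  have hmono : ∀ t, Monotone fun ξ => N.linkIntensity t (Iio ξ) :=
    fun t _ _ h => measure_mono (Iio_subset_Iio h)
  exact measurable_expNeg.comp (Finset.measurable_sum _ fun t _ => (hmono t).measurable)

lemma measurable_coverage (s : S) : Measurable (N.coverage s) :=
  (N.measurable_expNeg_linkIntensity_Iio.comp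
    (N.measurable_pathLoss_div s)).lintegral_prod_right'

lemma coverage_eq (s : S) {r : ℝ} (hr : 0 ≤ r) :
    N.coverage s r = ∫⁻ x, ENNReal.ofReal (Real.exp (-∑ t, N.Lambda t (N.pathLoss s r / x)))
      ∂(N.shadowLaw s) := by
  refine lintegral_congr_ae ?_
  filter_upwards [N.ae_shadowLaw_pos s] with x hx
  have hξ : 0 ≤ N.pathLoss s r / x := div_nonneg (N.pathLoss_nonneg s hr) hx.le
  have hLambda : ∀ t ∈ Finset.univ, 0 ≤ N.Lambda t (N.pathLoss s r / x) :=
    fun t _ => N.Lambda_nonneg t hξ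
  simp_rw [N.linkIntensity_Iio _ hξ]
  rw [← ENNReal.ofReal_sum_of_nonneg hLambda, expNeg_ofReal (Finset.sum_nonneg hLambda)]

end NetworkParams

namespace LinkField

variable {S : Type*} [Fintype S] [MeasurableSpace S] [MeasurableSingletonClass S]
  {N : NetworkParams S} {M : Type*} [MeasurableSpace M] {ν : Measure M}
  (F : LinkField N ν)

lemma measurableSet_cell :
    MeasurableSet {q : (ℕ × Config M) × Plane | q.2 ∈ F.cell q.1.2 q.1.1} := by
  change MeasurableSet {q : (ℕ × Config M) × Plane |
    ∀ k, F.invPower q.2 (q.1.2 q.1.1) ≤ F.invPower q.2 (q.1.2 k)}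
  simp_rw [ofPred_forall]
  refine MeasurableSet.iInter fun k => measurableSet_le ?_ ?_
  · exact F.measurable_invPower.comp
      (measurable_snd.prodMk (measurable_typicalPoint.comp measurable_fst))
  · exact F.measurable_invPower.comp (measurable_snd.prodMk
      ((measurable_pi_apply k).comp (measurable_snd.comp measurable_fst)))

lemma measurable_volume_cell :
    Measurable fun a : ℕ × Config M => volume (F.cell a.2 a.1) :=
  measurable_measure_prodMk_left F.measurableSet_cell

lemma meanCellArea_eq_lintegral (Q : Measure (ℕ × Config M)) [SFinite Q] :
    meanCellArea F Q = ∫⁻ z, Q {a | z ∈ F.cell a.2 a.1} :=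
  (Measure.prod_apply F.measurableSet_cell).symm.trans
    (Measure.prod_apply_symm F.measurableSet_cell)

lemma measurableSet_mem_cell (z : Plane) :
    MeasurableSet {a : ℕ × Config M | z ∈ F.cell a.2 a.1} :=
  measurable_prodMk_right F.measurableSet_cell

lemma measurableSet_linkState_typicalPoint (z : Plane) (s : S) :
    MeasurableSet {a : ℕ × Config M | F.linkState z (a.2 a.1) = s} :=
  measurable_typicalPoint (F.measurableSet_linkState_eq z s)

variable [IsProbabilityMeasure ν] {Ω : Type*} [MeasurableSpace Ω] {P : Measure Ω}
  {X : ℕ → Ω → Plane} {K : ℕ → Ω → M} {W : Set Plane}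
  (hY : IsPoissonProcess P (N.bsIntensity ν) fun n ω => (X n ω, K n ω))
  (hW : MeasurableSet W) (hWzero : volume W ≠ 0) (hWtop : volume W ≠ ⊤)

include hY hW hWzero hWtop

lemma palm_linkState (z : Plane) (s : S) :
    palm P N.lam X K W {a | F.linkState z (a.2 a.1) = s} = ENNReal.ofReal (N.p s ‖z‖) := by
  have hmark := palm_mark_mem_and_void hY hW hWzero hWtop (F.measurableSet_state_eq z s)
    MeasurableSet.empty
  simp only [mem_empty_iff_false, not_false_eq_true, implies_true, and_true, ofPred_false,
    measure_empty, expNeg_zero, lintegral_one, Measure.restrict_apply_univ,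
    F.measure_state_eq] at hmark
  rw [← hmark]
  refine measure_congr ?_
  filter_upwards [palm_ae_typicalPoint (W := W) (P := P) (fun n => (hY.measurable n).fst)
    (fun n => (hY.measurable n).snd) N.lam] with a ha
  change (F.linkState z (a.2 a.1) = s) = (F.state z (a.2 a.1).2 = s)
  rw [linkState, ha, sub_zero]

lemma palm_linkState_and_mem_cell (z : Plane) (s : S) :
    palm P N.lam X K W {a | F.linkState z (a.2 a.1) = s ∧ z ∈ F.cell a.2 a.1} =
      ENNReal.ofReal (N.p s ‖z‖) * N.coverage s ‖z‖ := by
  have hstate := F.measurableSet_state_eq z s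
  have hbetter :
      MeasurableSet {q : M × (Plane × M) | F.invPower z q.2 < F.invPower z (0, q.1)} :=
    measurableSet_lt ((F.measurable_invPower_right z).comp measurable_snd)
      ((F.measurable_invPower_right z).comp (measurable_const.prodMk measurable_fst))
  have hshadow : ∫⁻ m in {m | F.state z m = s}, expNeg (N.bsIntensity ν
      {b | (m, b) ∈ {q : M × (Plane × M) | F.invPower z q.2 < F.invPower z (0, q.1)}}) ∂ν =
      ENNReal.ofReal (N.p s ‖z‖) * N.coverage s ‖z‖ := by
    have hlink : Measurable fun x =>
        expNeg (∑ t, N.linkIntensity t (Iio (N.pathLoss s ‖z‖ / x))) :=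
      N.measurable_expNeg_linkIntensity_Iio.comp (measurable_const.div measurable_id)
    rw [NetworkParams.coverage, ← F.setLIntegral_state_eq z s hlink]
    refine setLIntegral_congr_fun hstate fun m (hm : F.state z m = s) => congrArg expNeg ?_
    have htypical : F.invPower z (0, m) = N.pathLoss s ‖z‖ / F.shadow z m := by
      rw [invPower, linkState, sub_zero, hm]
    rw [← htypical]
    exact F.bsIntensity_invPower_mem z (measurableSet_Iio (a := F.invPower z (0, m)))
  rw [← hshadow, ← palm_mark_mem_and_void hY hW hWzero hWtop hstate hbetter]
  refine measure_congr ?_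
  filter_upwards [palm_ae_typicalPoint (W := W) (P := P) (fun n => (hY.measurable n).fst)
    (fun n => (hY.measurable n).snd) N.lam] with a ha
  have horigin : a.2 a.1 = (0, (a.2 a.1).2) := Prod.ext ha rfl
  change (F.linkState z (a.2 a.1) = s ∧ ∀ k, F.invPower z (a.2 a.1) ≤ F.invPower z (a.2 k)) =
    (F.state z (a.2 a.1).2 = s ∧ ∀ k, k ≠ a.1 →
      ¬ F.invPower z (a.2 k) < F.invPower z (0, (a.2 a.1).2))
  rw [← horigin, linkState, ha, sub_zero]
  simp only [not_lt, eq_iff_iff]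
  refine and_congr_right fun _ => ⟨fun h k _ => h k, fun h k => ?_⟩
  obtain rfl | hk := eq_or_ne k a.1
  exacts [le_rfl, h k hk]

lemma palm_cell (z : Plane) :
    palm P N.lam X K W {a | z ∈ F.cell a.2 a.1} =
      ∑ s, ENNReal.ofReal (N.p s ‖z‖) * N.coverage s ‖z‖ := by
  simp_rw [← F.palm_linkState_and_mem_cell hY hW hWzero hWtop z]
  rw [← measure_biUnion_finset]
  · congr 1
    ext a
    simp
  · exact fun s _ t _ hst => Set.disjoint_left.2 fun a hs ht => hst (hs.1.symm.trans ht.1)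
  · exact fun s _ =>
      (F.measurableSet_linkState_typicalPoint z s).inter (F.measurableSet_mem_cell z)

lemma meanCellArea_palm :
    meanCellArea F (palm P N.lam X K W) = ENNReal.ofReal (2 * Real.pi) *
      ∑ s, ∫⁻ r, N.coverage s r ∂(N.radialMeasure s) := by
  have := isProbabilityMeasure_palm hY hW hWzero hWtop
  have hradial : ∀ s, Measurable fun z : Plane =>
      ENNReal.ofReal (N.p s ‖z‖) * N.coverage s ‖z‖ := fun s =>
    ((N.measurable_p s).ennreal_ofReal.mul (N.measurable_coverage s)).comp measurable_norm
  rw [F.meanCellArea_eq_lintegral]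
  simp_rw [F.palm_cell hY hW hWzero hWtop]
  rw [lintegral_finsetSum _ fun s _ => hradial s, Finset.mul_sum]
  exact Finset.sum_congr rfl fun s _ => N.lintegral_p_norm_mul s (N.measurable_coverage s)

-- The factor `p s ‖z‖` absorbs the junk value of the conditional probability at `p s ‖z‖ = 0`.
lemma cond_palm_cell_mul (z : Plane) (s : S) :
    (ProbabilityTheory.cond (palm P N.lam X K W) {a | F.linkState z (a.2 a.1) = s})
      {a | z ∈ F.cell a.2 a.1} * ENNReal.ofReal (N.p s ‖z‖ * ‖z‖) =
      N.coverage s ‖z‖ * ENNReal.ofReal (N.p s ‖z‖ * ‖z‖) := by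
  rw [cond_apply (F.measurableSet_linkState_typicalPoint z s), ← ofPred_and,
    F.palm_linkState hY hW hWzero hWtop, F.palm_linkState_and_mem_cell hY hW hWzero hWtop]
  obtain hp | hp := eq_or_ne (ENNReal.ofReal (N.p s ‖z‖)) 0
  · simp [hp, ENNReal.ofReal_mul (N.p_nonneg s _)]
  · rw [← mul_assoc, ENNReal.inv_mul_cancel hp ENNReal.ofReal_ne_top, one_mul]

lemma palm_others (z : Plane) (t : S) {ξ : ℝ} (hξ : 0 ≤ ξ) :
    palm P N.lam X K W
        {a | ∀ k, k ≠ a.1 → F.linkState z (a.2 k) = t → ξ < F.invPower z (a.2 k)} =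
      expNeg (ENNReal.ofReal (N.Lambda t ξ)) := by
  have hnear : MeasurableSet
      {q : M × (Plane × M) | F.linkState z q.2 = t ∧ F.invPower z q.2 ∈ Iic ξ} :=
    measurable_snd (F.measurableSet_linkState_eq_and_invPower_mem z t measurableSet_Iic)
  have hvoid := palm_mark_mem_and_void hY hW hWzero hWtop MeasurableSet.univ hnear
  have hintensity := F.bsIntensity_linkState_eq_and_invPower_mem z t (measurableSet_Iic (a := ξ))
  rw [N.linkIntensity_Iic t hξ] at hintensity
  simp only [mem_ofPred_eq, hintensity, mem_univ, true_and, lintegral_const, measure_univ, mul_one,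
    Measure.restrict_univ] at hvoid
  rw [← hvoid]
  congr 1
  ext a
  simp

lemma lintegral_prod_palm_others (z : Plane) (s : S) {r : ℝ} (hr : 0 ≤ r) :
    ∫⁻ x, ∏ t, (palm P N.lam X K W) {a | ∀ k, k ≠ a.1 → F.linkState z (a.2 k) = t →
      N.pathLoss s r / x < F.invPower z (a.2 k)} ∂(N.shadowLaw s) = N.coverage s r := by
  refine lintegral_congr_ae ?_
  filter_upwards [N.ae_shadowLaw_pos s] with x hx
  have hξ : 0 ≤ N.pathLoss s r / x := div_nonneg (N.pathLoss_nonneg s hr) hx.le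
  simp_rw [F.palm_others hY hW hWzero hWtop z _ hξ, N.linkIntensity_Iio _ hξ]
  exact (expNeg_sum _ _).symm

end LinkField

namespace LinkField

variable {S : Type*} [Fintype S] [MeasurableSpace S]
  {N : NetworkParams S} {M : Type*} [MeasurableSpace M] {ν : Measure M}
  (F : LinkField N ν)

/-- The almost sure properties of a configuration that make the serving base station of the origin
exist and be unique: the inverse powers received there are positive, distinct and locally finite. -/
structure Regular (c : Config M) : Prop where
  pos : ∀ n, 0 < F.invPower 0 (c n)
  ne : ∀ n k, k ≠ n → F.invPower 0 (c k) ≠ F.invPower 0 (c n)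
  finite : ∀ j : ℕ, {n | F.invPower 0 (c n) ≤ j}.Finite

variable {F} {c : Config M}

lemma Regular.exists_min (h : F.Regular c) (T : Set ℕ) (hT : T.Nonempty) :
    ∃ n ∈ T, ∀ k ∈ T, F.invPower 0 (c n) ≤ F.invPower 0 (c k) := by
  obtain ⟨m, hm⟩ := hT
  obtain ⟨j, hj⟩ := exists_nat_ge (F.invPower 0 (c m))
  obtain ⟨n, ⟨hnj, hnT⟩, hmin⟩ := Set.exists_min_image ({n | F.invPower 0 (c n) ≤ j} ∩ T)
    (fun n => F.invPower 0 (c n)) ((h.finite j).inter_of_left T) ⟨m, hj, hm⟩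
  refine ⟨n, hnT, fun k hk => ?_⟩
  rcases le_total (F.invPower 0 (c k)) j with hkj | hjk
  · exact hmin k ⟨hkj, hk⟩
  · exact le_trans hnj hjk

lemma Regular.exists_serves (h : F.Regular c) : ∃ n, F.Serves c n 0 := by
  obtain ⟨n, -, hn⟩ := h.exists_min univ univ_nonempty
  exact ⟨n, fun k => hn k (mem_univ k)⟩

lemma Regular.serves_unique (h : F.Regular c) {n k : ℕ} (hn : F.Serves c n 0)
    (hk : F.Serves c k 0) : n = k := by
  by_contra hne
  exact h.ne k n hne (le_antisymm (hn k) (hk n))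

lemma minInvPower_le {s : S} {n : ℕ} (hn : F.linkState 0 (c n) = s) :
    F.minInvPower s c ≤ ENNReal.ofReal (F.invPower 0 (c n)) :=
  (iInf_le _ n).trans (if_pos hn).le

lemma Regular.minInvPower_eq (h : F.Regular c) (s : S) (hs : F.minInvPower s c ≠ ⊤) :
    ∃ n, F.linkState 0 (c n) = s ∧ F.minInvPower s c = ENNReal.ofReal (F.invPower 0 (c n)) := by
  have hnonempty : {n | F.linkState 0 (c n) = s}.Nonempty := by
    by_contra hempty
    exact hs (iInf_eq_top.2 fun n => if_neg fun hn => hempty ⟨n, hn⟩)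
  obtain ⟨n, hn, hmin⟩ := h.exists_min _ hnonempty
  refine ⟨n, hn, le_antisymm (minInvPower_le hn) (le_iInf fun k => ?_)⟩
  split_ifs with hk
  · exact ENNReal.ofReal_le_ofReal (hmin k hk)
  · exact le_top

lemma Regular.lt_minInvPower_iff (h : F.Regular c) (s : S) {x : ℝ} :
    ENNReal.ofReal x < F.minInvPower s c ↔
      ∀ k, F.linkState 0 (c k) = s → x < F.invPower 0 (c k) := by
  constructor
  · exact fun hlt k hk => (ENNReal.ofReal_lt_ofReal_iff (h.pos k)).1
      (hlt.trans_le (minInvPower_le hk))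
  · intro hall
    obtain htop | hfinite := eq_or_ne (F.minInvPower s c) ⊤
    · rw [htop]
      exact ENNReal.ofReal_lt_top
    · obtain ⟨n, hn, hmin⟩ := h.minInvPower_eq s hfinite
      rw [hmin]
      exact (ENNReal.ofReal_lt_ofReal_iff (h.pos n)).2 (hall n hn)

lemma Regular.exists_serves_iff (h : F.Regular c) (s : S) :
    (∃ n, F.Serves c n 0 ∧ F.linkState 0 (c n) = s) ↔
      F.minInvPower s c ≠ ⊤ ∧ ∀ t, t ≠ s → F.minInvPower s c < F.minInvPower t c := by
  constructor
  · rintro ⟨n, hn, hs⟩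
    have hle := minInvPower_le hs
    refine ⟨(hle.trans_lt ENNReal.ofReal_lt_top).ne, fun t ht => hle.trans_lt ?_⟩
    refine (h.lt_minInvPower_iff t).2 fun k hk => lt_of_le_of_ne (hn k) (h.ne k n ?_)
    rintro rfl
    exact ht (hk.symm.trans hs)
  · rintro ⟨-, hall⟩
    obtain ⟨n, hn⟩ := h.exists_serves
    refine ⟨n, hn, ?_⟩
    by_contra hns
    have hlt := (hall _ hns).trans_le (minInvPower_le rfl)
    obtain ⟨k, -, hmin⟩ := h.minInvPower_eq s (hlt.trans ENNReal.ofReal_lt_top).ne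
    rw [hmin, ENNReal.ofReal_lt_ofReal_iff (h.pos n)] at hlt
    exact (hn k).not_gt hlt

end LinkField

lemma NetworkParams.linkIntensity_Iic_zero {S : Type*} [Fintype S] (N : NetworkParams S) (s : S) :
    N.linkIntensity s (Iic 0) = 0 := by
  have hradius : ∀ x : ℝ, (x * 0 / N.kappa s) ^ (1 / N.alpha s) = 0 := fun x => by
    rw [mul_zero, zero_div, Real.zero_rpow (one_div_pos.2 (N.alpha_pos s)).ne']
  rw [N.linkIntensity_Iic s le_rfl, NetworkParams.Lambda]
  simp_rw [hradius]
  simp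

namespace LinkField

variable {S : Type*} [Fintype S] [MeasurableSpace S] [MeasurableSingletonClass S]
  {N : NetworkParams S} {M : Type*} [MeasurableSpace M] {ν : Measure M} (F : LinkField N ν)

lemma measurable_minInvPower (s : S) : Measurable (F.minInvPower s : Config M → ℝ≥0∞) :=
  Measurable.iInf fun n => Measurable.ite
    ((measurable_pi_apply n : Measurable fun c : Config M => c n)
      (F.measurableSet_linkState_eq 0 s))
    ((F.measurable_invPower_right 0).comp (measurable_pi_apply n)).ennreal_ofReal measurable_const

lemma measurableSet_serves_and_linkState_eq (n : ℕ) (s : S) :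
    MeasurableSet {c : Config M | F.Serves c n 0 ∧ F.linkState 0 (c n) = s} := by
  refine MeasurableSet.inter ?_ ((measurable_pi_apply n : Measurable fun c : Config M => c n)
    (F.measurableSet_linkState_eq 0 s))
  change MeasurableSet {c : Config M | F.Serves c n 0}
  simp_rw [Serves, ofPred_forall]
  exact MeasurableSet.iInter fun k => measurableSet_le
    ((F.measurable_invPower_right 0).comp (measurable_pi_apply n))
    ((F.measurable_invPower_right 0).comp (measurable_pi_apply k))

section MarkedProcess

variable {Ω : Type*} [MeasurableSpace Ω] {X : ℕ → Ω → Plane} {K : ℕ → Ω → M}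
  (hX : ∀ n, Measurable (X n)) (hK : ∀ n, Measurable (K n))

include hX hK

lemma measurable_minLink (s : S) : Measurable (minLink F X K s) :=
  (F.measurable_minInvPower s).comp
    (measurable_pi_lambda _ fun n => (hX n).prodMk (hK n))

lemma measurableSet_config_serves_and_linkState_eq (n : ℕ) (s : S) : MeasurableSet
    {ω | F.Serves (config X K ω) n 0 ∧ F.linkState 0 (config X K ω n) = s} :=
  (measurable_pi_lambda _ fun k => (hX k).prodMk (hK k) : Measurable (config X K))
    (F.measurableSet_serves_and_linkState_eq n s)

lemma measurableSet_exists_serves (s : S) : MeasurableSet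
    {ω | ∃ n, F.Serves (config X K ω) n 0 ∧ F.linkState 0 (config X K ω n) = s} := by
  rw [ofPred_exists]
  exact MeasurableSet.iUnion fun n =>
    F.measurableSet_config_serves_and_linkState_eq hX hK n s

end MarkedProcess

lemma measurableSet_linkState_mem_and_invPower_le (z : Plane) (T : Finset S) (x : S → ℝ) :
    MeasurableSet {b | F.linkState z b ∈ T ∧ F.invPower z b ≤ x (F.linkState z b)} := by
  convert T.measurableSet_biUnion fun s _ =>
    F.measurableSet_linkState_eq_and_invPower_mem z s (measurableSet_Iic (a := x s)) using 1
  ext b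
  simp

variable [IsProbabilityMeasure ν]

lemma bsIntensity_linkState_mem_and_invPower_le (z : Plane) (T : Finset S) {x : S → ℝ}
    (hx : ∀ s, 0 ≤ x s) :
    N.bsIntensity ν {b | F.linkState z b ∈ T ∧ F.invPower z b ≤ x (F.linkState z b)} =
      ∑ s ∈ T, ENNReal.ofReal (N.Lambda s (x s)) := by
  simp_rw [← N.linkIntensity_Iic _ (hx _),
    ← F.bsIntensity_linkState_eq_and_invPower_mem z _ measurableSet_Iic]
  rw [← measure_biUnion_finset]
  · congr 1
    ext b
    simp
  · exact fun s _ t _ hst => Set.disjoint_left.2 fun b hs ht => hst (hs.1.symm.trans ht.1)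
  · exact fun s _ => F.measurableSet_linkState_eq_and_invPower_mem z s measurableSet_Iic

variable {Ω : Type*} [MeasurableSpace Ω] {P : Measure Ω}
  {X : ℕ → Ω → Plane} {K : ℕ → Ω → M}
  (hY : IsPoissonProcess P (N.bsIntensity ν) fun n ω => (X n ω, K n ω))

include hY

lemma ae_regular : ∀ᵐ ω ∂P, F.Regular (config X K ω) := by
  have hinv := F.measurable_invPower_right 0
  have hpos : ∀ᵐ ω ∂P, ∀ n, (X n ω, K n ω) ∉ {b | F.invPower 0 b ∈ Iic (0 : ℝ)} := by
    refine hY.ae_notMem (hinv measurableSet_Iic) ?_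
    rw [F.bsIntensity_invPower_mem 0 measurableSet_Iic]
    exact Finset.sum_eq_zero fun t _ => N.linkIntensity_Iic_zero t
  have hne : ∀ᵐ ω ∂P, ∀ n k, k ≠ n → ((X n ω, K n ω), (X k ω, K k ω)) ∉
      {q : (Plane × M) × (Plane × M) | F.invPower 0 q.2 = F.invPower 0 q.1} := by
    refine hY.ae_pairwise_notMem
      (measurableSet_eq_fun (hinv.comp measurable_snd) (hinv.comp measurable_fst)) fun y => ?_
    refine (F.bsIntensity_invPower_mem 0 (measurableSet_singleton (F.invPower 0 y))).trans ?_
    exact Finset.sum_eq_zero fun t _ => N.linkIntensity_absolutelyContinuous t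
      Real.volume_singleton
  have hfinite : ∀ᵐ ω ∂P, ∀ j : ℕ,
      {n | (X n ω, K n ω) ∈ {b | F.invPower 0 b ∈ Iic (j : ℝ)}}.Finite := by
    refine ae_all_iff.2 fun j => hY.ae_finite (hinv measurableSet_Iic) ?_
    rw [F.bsIntensity_invPower_mem 0 measurableSet_Iic]
    simp_rw [N.linkIntensity_Iic _ (Nat.cast_nonneg j)]
    exact ENNReal.sum_ne_top.2 fun t _ => ENNReal.ofReal_ne_top
  filter_upwards [hpos, hne, hfinite] with ω hposω hneω hfiniteω
  exact ⟨fun n => not_le.1 (hposω n), fun n k hk => hneω n k hk, hfiniteω⟩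

-- `BS n` serves the origin iff no other base station has a smaller inverse power, so this is the
-- Slivnyak-Mecke void formula with the mobile terminal in the role of the fixed point.
lemma tsum_measure_serves (s : S) :
    ∑' n, P {ω | F.Serves (config X K ω) n 0 ∧ F.linkState 0 (config X K ω n) = s} =
      ENNReal.ofReal (2 * Real.pi * N.lam) * ∫⁻ r, N.coverage s r ∂(N.radialMeasure s) := by
  have hinv := F.measurable_invPower_right 0
  have hmecke := hY.tsum_measure_mem_and_void (F.measurableSet_linkState_eq 0 s)
    (measurableSet_lt (hinv.comp measurable_snd) (hinv.comp measurable_fst))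
  have hbetter : ∀ y : Plane × M, N.bsIntensity ν (Prod.mk y ⁻¹'
      {q : (Plane × M) × (Plane × M) | F.invPower 0 q.2 < F.invPower 0 q.1}) =
      ∑ t, N.linkIntensity t (Iio (F.invPower 0 y)) := fun y =>
    F.bsIntensity_invPower_mem 0 (measurableSet_Iio (a := F.invPower 0 y))
  simp only [Function.comp_apply, hbetter] at hmecke
  rw [F.setLIntegral_linkState_eq 0 s N.measurable_expNeg_linkIntensity_Iio,
    N.lintegral_linkIntensity s N.measurable_expNeg_linkIntensity_Iio] at hmecke
  refine Eq.trans (tsum_congr fun n => congrArg P ?_) hmecke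
  ext ω
  refine and_comm.trans (and_congr_right fun _ => ⟨fun h k _ => not_lt.2 (h k), fun h k => ?_⟩)
  obtain rfl | hk := eq_or_ne k n
  exacts [le_rfl, not_lt.1 (h k hk)]

lemma assocProb_eq_lintegral_coverage (s : S) :
    assocProb P F X K s =
      ENNReal.ofReal (2 * Real.pi * N.lam) * ∫⁻ r, N.coverage s r ∂(N.radialMeasure s) := by
  rw [← F.tsum_measure_serves hY, assocProb, ofPred_exists, measure_iUnion₀]
  · intro n k hnk
    refine measure_mono_null ?_ (ae_iff.1 (F.ae_regular hY))
    exact fun ω hω hreg => hnk (hreg.serves_unique hω.1.1 hω.2.1)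
  · exact fun n => (F.measurableSet_config_serves_and_linkState_eq
      (fun n => (hY.measurable n).fst) (fun n => (hY.measurable n).snd) n s).nullMeasurableSet

lemma sum_assocProb : ∑ s, assocProb P F X K s = 1 := by
  have := hY.isProbabilityMeasure
  have hserved := F.measurableSet_exists_serves
    (fun n => (hY.measurable n).fst) (fun n => (hY.measurable n).snd)
  unfold assocProb
  rw [← tsum_fintype (L := .unconditional _), ← measure_iUnion₀]
  · rw [← prob_compl_eq_zero_iff (MeasurableSet.iUnion hserved)]
    refine measure_mono_null ?_ (ae_iff.1 (F.ae_regular hY))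
    intro ω hω hreg
    obtain ⟨n, hn⟩ := hreg.exists_serves
    exact hω (mem_iUnion.2 ⟨_, n, hn, rfl⟩)
  · intro s t hst
    refine measure_mono_null ?_ (ae_iff.1 (F.ae_regular hY))
    rintro ω ⟨⟨n, hn, hs⟩, k, hk, ht⟩ hreg
    rw [hreg.serves_unique hn hk] at hs
    exact hst (hs.symm.trans ht)
  · exact fun s => (hserved s).nullMeasurableSet

lemma assocProb_eq_measure_minLink (s : S) :
    assocProb P F X K s = P {ω | minLink F X K s ω ≠ ⊤ ∧
      ∀ t, t ≠ s → minLink F X K s ω < minLink F X K t ω} := by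
  refine measure_congr ?_
  filter_upwards [F.ae_regular hY] with ω hω
  exact propext (hω.exists_serves_iff s)

lemma measure_forall_mem_lt_minLink (T : Finset S) {x : S → ℝ} (hx : ∀ s, 0 ≤ x s) :
    P {ω | ∀ s ∈ T, ENNReal.ofReal (x s) < minLink F X K s ω} =
      ∏ s ∈ T, ENNReal.ofReal (Real.exp (-N.Lambda s (x s))) := by
  have hvoid := hY.measure_void (F.measurableSet_linkState_mem_and_invPower_le 0 T x)
  rw [F.bsIntensity_linkState_mem_and_invPower_le 0 T hx, expNeg_sum] at hvoid
  simp_rw [expNeg_ofReal (N.Lambda_nonneg _ (hx _))] at hvoid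
  rw [← hvoid]
  refine measure_congr ?_
  filter_upwards [F.ae_regular hY] with ω hω
  refine propext ⟨fun hlt k hk => ?_, fun hk s hs => ?_⟩
  · exact hk.2.not_gt ((hω.lt_minInvPower_iff _).1 (hlt _ hk.1) k rfl)
  · refine (hω.lt_minInvPower_iff s).2 fun k hks => ?_
    subst hks
    exact not_le.1 fun hle => hk k ⟨hs, hle⟩

lemma measure_lt_minLink (s : S) {x : ℝ} (hx : 0 ≤ x) :
    P {ω | ENNReal.ofReal x < minLink F X K s ω} =
      ENNReal.ofReal (Real.exp (-N.Lambda s x)) := by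
  simpa using F.measure_forall_mem_lt_minLink hY {s} (x := fun _ => x) fun _ => hx

lemma iIndepFun_minLink : iIndepFun (fun s => minLink F X K s) P := by
  have := hY.isProbabilityMeasure
  refine iIndepFun_of_measure_forall_lt (F.measurable_minLink
    (fun n => (hY.measurable n).fst) (fun n => (hY.measurable n).snd)) fun T x => ?_
  by_cases htop : ∃ s ∈ T, x s = ⊤
  · obtain ⟨s, hs, hxs⟩ := htop
    have hempty : {ω | x s < minLink F X K s ω} = ∅ := by simp [hxs]
    rw [Finset.prod_eq_zero hs (by rw [hempty, measure_empty])]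
    exact measure_mono_null (t := {ω | x s < minLink F X K s ω}) (fun ω hω => hω s hs)
      (by rw [hempty, measure_empty])
  · push Not at htop
    have hcast : ∀ s ∈ T, ENNReal.ofReal (x s).toReal = x s := fun s hs =>
      ENNReal.ofReal_toReal (htop s hs)
    have hjoint := F.measure_forall_mem_lt_minLink hY T (x := fun s => (x s).toReal)
      fun s => ENNReal.toReal_nonneg
    simp_rw [← F.measure_lt_minLink hY _ ENNReal.toReal_nonneg] at hjoint
    rw [Finset.prod_congr rfl fun s hs => by rw [← hcast s hs], ← hjoint]
    congr 1
    ext ω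
    exact forall₂_congr fun s hs => by rw [hcast s hs]

end LinkField

namespace LinkField

variable {S : Type*} [Fintype S] [MeasurableSpace S] [MeasurableSingletonClass S]
  {N : NetworkParams S} {M : Type*} [MeasurableSpace M] {ν : Measure M} (F : LinkField N ν)
  [IsProbabilityMeasure ν] {Ω : Type*} [MeasurableSpace Ω] {P : Measure Ω}
  {X : ℕ → Ω → Plane} {K : ℕ → Ω → M}
  (hY : IsPoissonProcess P (N.bsIntensity ν) fun n ω => (X n ω, K n ω))

include hY

lemma minLinkLaw_apply_eq_zero (s : S) {U : Set ℝ} (hU : MeasurableSet U)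
    (hzero : N.linkIntensity s U = 0) : minLinkLaw P F X K s U = 0 := by
  have hL := F.measurable_minLink (fun n => (hY.measurable n).fst)
    (fun n => (hY.measurable n).snd) s
  rw [minLinkLaw, Measure.map_apply hL.ennreal_toReal hU,
    Measure.restrict_apply (hL.ennreal_toReal hU), measure_eq_zero_iff_ae_notMem]
  have hnone := hY.ae_notMem (F.measurableSet_linkState_eq_and_invPower_mem 0 s hU)
    ((F.bsIntensity_linkState_eq_and_invPower_mem 0 s hU).trans hzero)
  filter_upwards [hnone, F.ae_regular hY] with ω hω hreg
  rintro ⟨hmem, hfinite⟩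
  obtain ⟨n, hn, hmin⟩ := hreg.minInvPower_eq s hfinite
  refine hω n ⟨hn, ?_⟩
  rwa [mem_preimage, minLink, hmin, ENNReal.toReal_ofReal (hreg.pos n).le] at hmem

lemma minLinkLaw_absolutelyContinuous (s : S) : minLinkLaw P F X K s ≪ volume :=
  Measure.AbsolutelyContinuous.mk fun _ hU hzero =>
    F.minLinkLaw_apply_eq_zero hY s hU (N.linkIntensity_absolutelyContinuous s hzero)

lemma minLinkLaw_restrict_Ioi (s : S) :
    (minLinkLaw P F X K s).restrict (Ioi 0) = minLinkLaw P F X K s := by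
  refine Measure.restrict_eq_self_of_ae_mem ?_
  filter_upwards [measure_eq_zero_iff_ae_notMem.1
    (F.minLinkLaw_apply_eq_zero hY s measurableSet_Iic (N.linkIntensity_Iic_zero s))] with x hx
  exact not_le.1 (mt mem_Iic.2 hx)

variable [DecidableEq S]

lemma assocProb_eq_setLIntegral (s : S) :
    assocProb P F X K s = ∫⁻ ω in {ω | minLink F X K s ω ≠ ⊤},
      ∏ t ∈ Finset.univ.erase s, P {ω' | minLink F X K s ω < minLink F X K t ω'} ∂P := by
  have := hY.isProbabilityMeasure
  rw [F.assocProb_eq_measure_minLink hY]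
  exact measure_mem_and_forall_lt_of_iIndepFun (F.iIndepFun_minLink hY)
    (F.measurable_minLink (fun n => (hY.measurable n).fst) (fun n => (hY.measurable n).snd)) s
    (D := {⊤}ᶜ) (measurableSet_singleton ⊤).compl

lemma assocProb_eq_lintegral (s : S) :
    assocProb P F X K s =
      ∫⁻ ω, ∏ t ∈ Finset.univ.erase s, P {ω' | minLink F X K s ω < minLink F X K t ω'} ∂P := by
  have := hY.isProbabilityMeasure
  have hmin := measure_mem_and_forall_lt_of_iIndepFun (F.iIndepFun_minLink hY)
    (F.measurable_minLink (fun n => (hY.measurable n).fst) (fun n => (hY.measurable n).snd)) s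
    MeasurableSet.univ
  rw [preimage_univ, Measure.restrict_univ] at hmin
  rw [← hmin]
  refine measure_congr ?_
  filter_upwards [F.ae_regular hY] with ω hω
  refine propext ((hω.exists_serves_iff s).trans
    ⟨fun h => ⟨mem_univ _, h.2⟩, fun h => ⟨?_, h.2⟩⟩)
  obtain ⟨n, -⟩ := hω.exists_serves
  obtain hn | hn := eq_or_ne (F.linkState 0 (config X K ω n)) s
  · exact ((minInvPower_le hn).trans_lt ENNReal.ofReal_lt_top).ne
  · exact (h.2 _ hn).ne_top

lemma toReal_assocProb (s : S) :
    (assocProb P F X K s).toReal = ∫ ω, ∏ t ∈ Finset.univ.erase s,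
      (P⟦{ω' | minLink F X K s ω' < minLink F X K t ω'} |
        MeasurableSpace.comap (minLink F X K s) inferInstance⟧) ω ∂P := by
  have := hY.isProbabilityMeasure
  have hL := F.measurable_minLink (fun n => (hY.measurable n).fst)
    (fun n => (hY.measurable n).snd)
  have hcond : ∀ᵐ ω ∂P, ∀ t ∈ Finset.univ.erase s,
      (P⟦{ω' | minLink F X K s ω' < minLink F X K t ω'} |
        MeasurableSpace.comap (minLink F X K s) inferInstance⟧) ω =
        (P {ω' | minLink F X K s ω < minLink F X K t ω'}).toReal :=
    (Filter.eventually_all_finset _).2 fun t ht => condExp_lt_of_indepFun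
      ((F.iIndepFun_minLink hY).indepFun (Finset.ne_of_mem_erase ht).symm) (hL s) (hL t)
  have hprod : Measurable fun ω => ∏ t ∈ Finset.univ.erase s,
      P {ω' | minLink F X K s ω < minLink F X K t ω'} :=
    Finset.measurable_prod _ fun t _ => (measurable_measure_lt (minLink F X K t)).comp (hL s)
  rw [F.assocProb_eq_lintegral hY, ← integral_toReal hprod.aemeasurable
    (Filter.Eventually.of_forall fun _ => ENNReal.prod_lt_top fun _ _ => measure_lt_top P _)]
  refine integral_congr_ae ?_
  filter_upwards [hcond] with ω hω
  rw [ENNReal.toReal_prod]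
  exact Finset.prod_congr rfl fun t ht => (hω t ht).symm

lemma assocProb_eq_lintegral_minLinkPDF (s : S) :
    assocProb P F X K s = ∫⁻ x in Ioi (0 : ℝ),
      (∏ t ∈ Finset.univ.erase s, P {ω | ENNReal.ofReal x < minLink F X K t ω}) *
        minLinkPDF P F X K s x := by
  have := hY.isProbabilityMeasure
  have hL := F.measurable_minLink (fun n => (hY.measurable n).fst)
    (fun n => (hY.measurable n).snd) s
  have hprod : Measurable fun x : ℝ => ∏ t ∈ Finset.univ.erase s,
      P {ω | ENNReal.ofReal x < minLink F X K t ω} :=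
    Finset.measurable_prod _ fun t _ =>
      (measurable_measure_lt (minLink F X K t)).comp ENNReal.measurable_ofReal
  have hfinite : IsFiniteMeasure (minLinkLaw P F X K s) := by
    unfold minLinkLaw
    infer_instance
  calc assocProb P F X K s
    _ = ∫⁻ x, ∏ t ∈ Finset.univ.erase s,
          P {ω | ENNReal.ofReal x < minLink F X K t ω} ∂(minLinkLaw P F X K s) := by
      rw [F.assocProb_eq_setLIntegral hY, minLinkLaw, lintegral_map hprod hL.ennreal_toReal]
      refine setLIntegral_congr_fun (hL (measurableSet_singleton ⊤).compl) fun ω hω => ?_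
      simp only [ENNReal.ofReal_toReal hω]
    _ = ∫⁻ x in Ioi (0 : ℝ), ∏ t ∈ Finset.univ.erase s,
          P {ω | ENNReal.ofReal x < minLink F X K t ω} ∂(minLinkLaw P F X K s) := by
      rw [F.minLinkLaw_restrict_Ioi hY]
    _ = _ := by
      rw [← setLIntegral_rnDeriv_mul (F.minLinkLaw_absolutelyContinuous hY s) hprod.aemeasurable
        measurableSet_Ioi]
      exact lintegral_congr fun x => mul_comm _ _

end LinkField

namespace LinkField

variable {S : Type*} [Fintype S] [MeasurableSpace S] [MeasurableSingletonClass S]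
  {N : NetworkParams S} {M : Type*} [MeasurableSpace M] {ν : Measure M} (F : LinkField N ν)
  [IsProbabilityMeasure ν] {Ω : Type*} [MeasurableSpace Ω] {P : Measure Ω}
  {X : ℕ → Ω → Plane} {K : ℕ → Ω → M}
  (hY : IsPoissonProcess P (N.bsIntensity ν) fun n ω => (X n ω, K n ω))
  {W : Set Plane} (hW : MeasurableSet W) (hWzero : volume W ≠ 0) (hWtop : volume W ≠ ⊤)

include hY hW hWzero hWtop

lemma meanCellArea_palm_eq_setLIntegral :
    meanCellArea F (palm P N.lam X K W) = ENNReal.ofReal (2 * Real.pi) *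
      ∑ s, ∫⁻ r in Ioi (0 : ℝ), N.coverage s r * ENNReal.ofReal (N.p s r * r) := by
  simp_rw [F.meanCellArea_palm hY hW hWzero hWtop,
    N.lintegral_radialMeasure _ (N.measurable_coverage _)]

lemma meanCellArea_palm_eq_cond {u : Plane} (hu : ‖u‖ = 1) :
    meanCellArea F (palm P N.lam X K W) =
      ENNReal.ofReal (2 * Real.pi) * ∑ s, ∫⁻ r in Ioi (0 : ℝ),
        (ProbabilityTheory.cond (palm P N.lam X K W) {a | F.linkState (r • u) (a.2 a.1) = s})
          {a | r • u ∈ F.cell a.2 a.1} * ENNReal.ofReal (N.p s r * r) := by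
  rw [F.meanCellArea_palm_eq_setLIntegral hY hW hWzero hWtop]
  congr! 2 with s
  refine setLIntegral_congr_fun measurableSet_Ioi fun r (hr : 0 < r) => ?_
  have hnorm : ‖r • u‖ = r := by rw [norm_smul, hu, mul_one, Real.norm_of_nonneg hr.le]
  simpa only [hnorm] using (F.cond_palm_cell_mul hY hW hWzero hWtop (r • u) s).symm

lemma meanCellArea_palm_eq_prod_others (u : Plane) :
    meanCellArea F (palm P N.lam X K W) =
      ENNReal.ofReal (2 * Real.pi) * ∑ s, ∫⁻ r in Ioi (0 : ℝ),
        (∫⁻ x, ∏ t, (palm P N.lam X K W)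
            {a | ∀ k, k ≠ a.1 → F.linkState (r • u) (a.2 k) = t →
              N.pathLoss s r / x < F.invPower (r • u) (a.2 k)} ∂(N.shadowLaw s)) *
          ENNReal.ofReal (N.p s r * r) := by
  rw [F.meanCellArea_palm_eq_setLIntegral hY hW hWzero hWtop]
  congr! 2 with s
  refine setLIntegral_congr_fun measurableSet_Ioi fun r (hr : 0 < r) => ?_
  simp only [F.lintegral_prod_palm_others hY hW hWzero hWtop (r • u) s hr.le]

lemma meanCellArea_palm_eq_exp :
    meanCellArea F (palm P N.lam X K W) =
      ENNReal.ofReal (2 * Real.pi) * ∑ s, ∫⁻ r in Ioi (0 : ℝ),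
        (∫⁻ x, ENNReal.ofReal (Real.exp (-∑ t, 2 * Real.pi * N.lam *
            ∫ x', (∫ ρ in (0 : ℝ)..N.cRadius s t r x' x, N.p t ρ * ρ) ∂(N.shadowLaw t)))
          ∂(N.shadowLaw s)) * ENNReal.ofReal (N.p s r * r) := by
  rw [F.meanCellArea_palm_eq_setLIntegral hY hW hWzero hWtop]
  congr! 2 with s
  refine setLIntegral_congr_fun measurableSet_Ioi fun r (hr : 0 < r) => ?_
  simp only [N.integral_cRadius_eq_Lambda, N.coverage_eq s hr.le]

lemma meanCellArea_palm_eq_sum_assocProb :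
    meanCellArea F (palm P N.lam X K W) = ∑ s, assocProb P F X K s / ENNReal.ofReal N.lam := by
  have hlam : ENNReal.ofReal N.lam ≠ 0 := (ENNReal.ofReal_pos.2 N.lam_pos).ne'
  rw [F.meanCellArea_palm hY hW hWzero hWtop, Finset.mul_sum]
  refine Finset.sum_congr rfl fun s _ => ?_
  rw [F.assocProb_eq_lintegral_coverage hY, ENNReal.eq_div_iff hlam ENNReal.ofReal_ne_top,
    ← mul_assoc, ← ENNReal.ofReal_mul N.lam_pos.le, mul_comm N.lam]

lemma meanCellArea_palm_eq_one_div :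
    meanCellArea F (palm P N.lam X K W) = 1 / ENNReal.ofReal N.lam := by
  simp_rw [F.meanCellArea_palm_eq_sum_assocProb hY hW hWzero hWtop, div_eq_mul_inv,
    ← Finset.sum_mul, F.sum_assocProb hY]

end LinkField

lemma NetworkParams.isPoissonProcess_bsIntensity {S : Type*} [Fintype S] (N : NetworkParams S)
    {M : Type*} [MeasurableSpace M] {ν : Measure M} {Ω : Type*} [MeasurableSpace Ω]
    {P : Measure Ω} [IsProbabilityMeasure P] {X : ℕ → Ω → Plane} {K : ℕ → Ω → M}
    (hX : IsHomogeneousPPP P N.lam X) (hK : IsIndependentMarking P X ν K) :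
    IsPoissonProcess P (N.bsIntensity ν) fun n ω => (X n ω, K n ω) := by
  have : SigmaFinite (ENNReal.ofReal N.lam • (volume : Measure Plane)) :=
    inferInstanceAs (SigmaFinite (N.lam.toNNReal • (volume : Measure Plane)))
  exact hK.isPoissonProcess_prod (hX.isPoissonProcess N.lam_pos)

end

theorem lemma1
    {S : Type*} [Fintype S] [DecidableEq S] [MeasurableSpace S] [MeasurableSingletonClass S]
    (N : NetworkParams S)
    {M : Type*} [MeasurableSpace M] (ν : Measure M) [IsProbabilityMeasure ν]
    (F : LinkField N ν)
    {Ω : Type*} [MeasurableSpace Ω] (P : Measure Ω) [IsProbabilityMeasure P]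
    (X : ℕ → Ω → Plane) (K : ℕ → Ω → M)
    (hX : IsHomogeneousPPP P N.lam X) (hK : IsIndependentMarking P X ν K) :
    -- the Palm mean area of the cells, for any choice of the window in the Palm distribution
    (∀ W : Set Plane, MeasurableSet W → volume W ≠ 0 → volume W ≠ ⊤ →
      IsProbabilityMeasure (palm P N.lam X K W) ∧
      -- the area of the cell of the typical base station is a random variable
      Measurable (fun a : ℕ × Config M => volume (F.cell a.2 a.1)) ∧
      -- the integral of the coverage probabilities, then the form with independent states;
      -- `r • u` is any location at distance `r` from the typical base station
      (∀ u : Plane, ‖u‖ = 1 →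
        meanCellArea F (palm P N.lam X K W) =
          ENNReal.ofReal (2 * Real.pi) * ∑ s, ∫⁻ r in Ioi (0 : ℝ),
            (ProbabilityTheory.cond (palm P N.lam X K W)
                {a | F.linkState (r • u) (a.2 a.1) = s})
              {a | r • u ∈ F.cell a.2 a.1} * ENNReal.ofReal (N.p s r * r) ∧
        meanCellArea F (palm P N.lam X K W) =
          ENNReal.ofReal (2 * Real.pi) * ∑ s, ∫⁻ r in Ioi (0 : ℝ),
            (∫⁻ x, ∏ t, (palm P N.lam X K W)
                {a | ∀ k, k ≠ a.1 → F.linkState (r • u) (a.2 k) = t →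
                  N.pathLoss s r / x < F.invPower (r • u) (a.2 k)} ∂(N.shadowLaw s)) *
              ENNReal.ofReal (N.p s r * r)) ∧
      -- explicit form, by the void probabilities
      meanCellArea F (palm P N.lam X K W) =
        ENNReal.ofReal (2 * Real.pi) * ∑ s, ∫⁻ r in Ioi (0 : ℝ),
          (∫⁻ x, ENNReal.ofReal (Real.exp (-∑ t, 2 * Real.pi * N.lam *
              ∫ x', (∫ ρ in (0 : ℝ)..N.cRadius s t r x' x, N.p t ρ * ρ) ∂(N.shadowLaw t)))
            ∂(N.shadowLaw s)) * ENNReal.ofReal (N.p s r * r) ∧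
      -- form with the association probabilities, and the value
      meanCellArea F (palm P N.lam X K W) =
        ∑ s, assocProb P F X K s / ENNReal.ofReal N.lam ∧
      meanCellArea F (palm P N.lam X K W) = 1 / ENNReal.ofReal N.lam) ∧
    -- the association probabilities
    (∀ s : S,
      (assocProb P F X K s).toReal =
        ∫ ω, ∏ t ∈ Finset.univ.erase s,
          (P⟦{ω' | minLink F X K s ω' < minLink F X K t ω'} |
            MeasurableSpace.comap (minLink F X K s) inferInstance⟧) ω ∂P ∧
      minLinkLaw P F X K s ≪ volume ∧
      assocProb P F X K s =
        ∫⁻ x in Ioi (0 : ℝ),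
          (∏ t ∈ Finset.univ.erase s, P {ω | ENNReal.ofReal x < minLink F X K t ω}) *
            minLinkPDF P F X K s x ∧
      ∀ x : ℝ, 0 ≤ x →
        P {ω | ENNReal.ofReal x < minLink F X K s ω} =
          ENNReal.ofReal (Real.exp (-N.Lambda s x))) := by
  have hY := N.isPoissonProcess_bsIntensity hX hK
  refine ⟨fun W hW hWzero hWtop => ⟨isProbabilityMeasure_palm hY hW hWzero hWtop,
    F.measurable_volume_cell, fun u hu => ⟨?_, ?_⟩, ?_, ?_, ?_⟩, fun s => ⟨?_, ?_, ?_, ?_⟩⟩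
  · exact F.meanCellArea_palm_eq_cond hY hW hWzero hWtop hu
  · exact F.meanCellArea_palm_eq_prod_others hY hW hWzero hWtop u
  · exact F.meanCellArea_palm_eq_exp hY hW hWzero hWtop
  · exact F.meanCellArea_palm_eq_sum_assocProb hY hW hWzero hWtop
  · exact F.meanCellArea_palm_eq_one_div hY hW hWzero hWtop
  · exact F.toReal_assocProb hY s
  · exact F.minLinkLaw_absolutelyContinuous hY s
  · exact F.assocProb_eq_lintegral_minLinkPDF hY s
  · exact fun x hx => F.measure_lt_minLink hY s hx
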